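/- Let $\Omega\subset\mathbb R^2$ be a bounded open set (for example a bounded, polygonal, simply connected domain). For $k=1,2$ let $H^k_0(\Omega)$ be the closure of $C_c^\infty(\Omega)$ in the real Sobolev space $H^k(\Omega)$, with the norm $\|v\|_{H^k(\Omega)}=\big(\sum_{|\alpha|\le k}\|\partial^\alpha v\|_{L^2(\Omega)}^2\big)^{1/2}$ (for polygonal $\Omega$: $v=0$ on $\partial\Omega$, respectively $v=\partial_n v=0$ on $\partial\Omega$), and let $H^{-2}(\Omega)=H^2_0(\Omega)^*$ with the dual norm. For $v\in H^2_0(\Omega)$ regard $\Delta v$ as the element $\varphi\mapsto(\Delta v,\varphi)_{L^2(\Omega)}$ of $H^{-2}(\Omega)$. For $T>0$ put $I=(0,T]$, $\bar I=[0,T]$ and $$\mathbb X=\{v\in L^2(I;H^2_0(\Omega)) : \partial_t\Delta v\in L^2(I;H^{-2}(\Omega))\},$$ where $\partial_t\Delta v=g$ means $\int_I\eta'(t)\,\Delta v(t)\,dt=-\int_I\eta(t)\,g(t)\,dt$ in $H^{-2}(\Omega)$ for all $\eta\in C_c^\infty((0,T))$. There is a constant $C>0$, depending only on $\Omega$, such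 that the following holds for every $T>0$. Every $v\in\mathbb X$ agrees a.e. in $I$ with exactly one function in $C(\bar I;H^1_0(\Omega))$, and $v(0)$ and $\|v\|_{C(\bar I;H^1_0(\Omega))}$ refer to that representative. For all $f\in L^2(I;H^{-2}(\Omega))$ and $\psi_0\in H^1_0(\Omega)$ there exists a unique $\psi\in\mathbb X$ with $$-\int_I\langle\partial_t\Delta\psi,\varphi\rangle\,dt+\int_I(\Delta\psi,\Delta\varphi)_{L^2(\Omega)}\,dt=\int_I\langle f,\varphi\rangle\,dt\quad\text{for all }\varphi\in L^2(I;H^2_0(\Omega)),\qquad \psi(0)=\psi_0 .$$ Moreover, $\psi\in C(\bar I;H^1_0(\Omega))$ (in the above sense) and $$\|\partial_t\Delta\psi\|_{L^2(I;H^{-2}(\Omega))}+\|\psi\|_{L^2(I;H^2_0(\Omega))}+\|\psi\|_{C(\bar I;H^1_0(\Omega))}\le C\big(\|f\|_{L^2(I;H^{-2}(\Omega))}+\|\nabla\psi_0\|_{L^2(\Omega)}\big).$$ -/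

import Mathlib

open MeasureTheory Set
open scoped ContDiff ENNReal

noncomputable section

namespace Biharm

/-! ### Sobolev spaces on an open subset of the plane -/

/-- The Euclidean plane. -/
abbrev Plane : Type := EuclideanSpace ℝ (Fin 2)

/-- Lebesgue measure on `Ω`. -/
abbrev vol (Ω : Set Plane) : Measure Plane := volume.restrict Ω

/-- The real Hilbert space `L²(Ω)`. -/
abbrev L2 (Ω : Set Plane) : Type := Lp ℝ 2 (vol Ω)

/-- `φ ∈ C_c^∞(Ω)`. -/
structure IsTestFunction (Ω : Set Plane) (φ : Plane → ℝ) : Prop where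
  contDiff : ContDiff ℝ ∞ φ
  hasCompactSupport : HasCompactSupport φ
  tsupport_subset : tsupport φ ⊆ Ω

/-- The classical partial derivative `∂_i φ`. -/
def partialDeriv (i : Fin 2) (φ : Plane → ℝ) : Plane → ℝ :=
  fun x => fderiv ℝ φ x (EuclideanSpace.single i 1)

/-- Multi-indices `α` in two variables with `|α| ≤ k`. -/
abbrev MultiIndex (k : ℕ) : Type :=
  {α : Fin 2 → Fin (k + 1) // (α 0 : ℕ) + (α 1 : ℕ) ≤ k}

/-- The length `|α|`. -/
def MultiIndex.length {k : ℕ} (α : MultiIndex k) : ℕ := (α.1 0 : ℕ) + (α.1 1 : ℕ)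

/-- The multi-index `0`. -/
def zeroIdx (k : ℕ) : MultiIndex k := ⟨fun _ => 0, by simp⟩

/-- The multi-index of `∂_i`. -/
def firstIdx (i : Fin 2) : MultiIndex 1 :=
  ⟨Pi.single i 1, by fin_cases i <;> decide⟩

/-- The multi-index of `∂_i²`. -/
def pureSecondIdx (i : Fin 2) : MultiIndex 2 :=
  ⟨Pi.single i 2, by fin_cases i <;> decide⟩

/-- The classical derivative `∂^α φ`. -/
def multiDeriv {k : ℕ} (α : MultiIndex k) (φ : Plane → ℝ) : Plane → ℝ :=
  (partialDeriv 0)^[(α.1 0 : ℕ)] ((partialDeriv 1)^[(α.1 1 : ℕ)] φ)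

/-- `v` is the weak derivative `∂^α u` on `Ω`. -/
def IsWeakDeriv {k : ℕ} (Ω : Set Plane) (α : MultiIndex k) (u v : L2 Ω) : Prop :=
  ∀ φ : Plane → ℝ, IsTestFunction Ω φ →
    ∫ x in Ω, u x * multiDeriv α φ x = (-1) ^ α.length * ∫ x in Ω, v x * φ x

theorem IsTestFunction.partialDeriv {Ω : Set Plane} {φ : Plane → ℝ} (h : IsTestFunction Ω φ)
    (i : Fin 2) : IsTestFunction Ω (Biharm.partialDeriv i φ) := by
  have hs : tsupport (Biharm.partialDeriv i φ) ⊆ tsupport φ :=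
    tsupport_fderiv_apply_subset ℝ (EuclideanSpace.single i 1)
  refine ⟨?_, ?_, hs.trans h.tsupport_subset⟩
  · exact (h.contDiff.fderiv_right (by simp)).clm_apply contDiff_const
  · exact h.hasCompactSupport.of_isClosed_subset (isClosed_tsupport _) hs

theorem IsTestFunction.multiDeriv {Ω : Set Plane} {φ : Plane → ℝ} (h : IsTestFunction Ω φ)
    {k : ℕ} (α : MultiIndex k) : IsTestFunction Ω (Biharm.multiDeriv α φ) := by
  have key : ∀ (i : Fin 2) (n : ℕ) {χ : Plane → ℝ}, IsTestFunction Ω χ →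
      IsTestFunction Ω ((Biharm.partialDeriv i)^[n] χ) := by
    intro i n
    induction n with
    | zero => intro χ hχ; exact hχ
    | succ n ih => intro χ hχ; exact ih (hχ.partialDeriv i)
  exact key 0 _ (key 1 _ h)

theorem IsTestFunction.memLp {Ω : Set Plane} {φ : Plane → ℝ} (h : IsTestFunction Ω φ) :
    MemLp φ 2 (vol Ω) :=
  (h.contDiff.continuous.memLp_of_hasCompactSupport h.hasCompactSupport).restrict Ω

theorem integrable_mul_test {Ω : Set Plane} (u : L2 Ω) {φ : Plane → ℝ}
    (h : IsTestFunction Ω φ) : Integrable (fun x => u x * φ x) (vol Ω) :=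
  (Lp.memLp u).integrable_mul h.memLp

theorem integral_add_mul_test {Ω : Set Plane} (u v : L2 Ω) {φ : Plane → ℝ}
    (h : IsTestFunction Ω φ) :
    ∫ x in Ω, (u + v : L2 Ω) x * φ x = (∫ x in Ω, u x * φ x) + ∫ x in Ω, v x * φ x := by
  rw [← integral_add (integrable_mul_test u h) (integrable_mul_test v h)]
  refine integral_congr_ae ?_
  filter_upwards [Lp.coeFn_add u v] with x hx
  rw [hx, Pi.add_apply, add_mul]

theorem integral_smul_mul_test {Ω : Set Plane} (c : ℝ) (u : L2 Ω) (φ : Plane → ℝ) :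
    ∫ x in Ω, (c • u : L2 Ω) x * φ x = c * ∫ x in Ω, u x * φ x := by
  rw [← integral_const_mul]
  refine integral_congr_ae ?_
  filter_upwards [Lp.coeFn_smul c u] with x hx
  rw [hx, Pi.smul_apply, smul_eq_mul, mul_assoc]

/-- The Sobolev space `H^k(Ω)`. A function `u` is stored with all its weak derivatives
`(∂^α u)_{|α| ≤ k}`, which are determined by `u`; the norm is `(∑_{|α| ≤ k} ‖∂^α u‖²)^{1/2}`. -/
def sobolev (k : ℕ) (Ω : Set Plane) :
    Submodule ℝ (PiLp 2 (fun _ : MultiIndex k => L2 Ω)) where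
  carrier := {U | ∀ α : MultiIndex k, IsWeakDeriv Ω α (U (zeroIdx k)) (U α)}
  zero_mem' := by
    intro α φ hφ
    have h1 := integral_smul_mul_test (Ω := Ω) 0 0 (multiDeriv α φ)
    have h2 := integral_smul_mul_test (Ω := Ω) 0 0 φ
    simp only [smul_zero, zero_mul] at h1 h2
    simp only [PiLp.zero_apply, h1, h2, mul_zero]
  add_mem' := by
    intro U V hU hV α φ hφ
    simp only [PiLp.add_apply]
    rw [integral_add_mul_test _ _ (hφ.multiDeriv α), integral_add_mul_test _ _ hφ,
      hU α φ hφ, hV α φ hφ, mul_add]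
  smul_mem' := by
    intro c U hU α φ hφ
    simp only [PiLp.smul_apply]
    rw [integral_smul_mul_test, integral_smul_mul_test, hU α φ hφ]
    ring

/-- `U ∈ H^k(Ω)` is (the class of) a function in `C_c^∞(Ω)`. -/
def IsTestElement {k : ℕ} {Ω : Set Plane} (U : sobolev k Ω) : Prop :=
  ∃ φ : Plane → ℝ, IsTestFunction Ω φ ∧ ∀ α : MultiIndex k, U.1 α =ᵐ[vol Ω] multiDeriv α φ

/-- The closure of `C_c^∞(Ω)` in `H^k(Ω)`. For polygonal `Ω` and `k = 1, 2` these are the elements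
of `H^k(Ω)` with `v = 0`, respectively `v = ∂_n v = 0`, on the boundary. -/
def sobolevZero (k : ℕ) (Ω : Set Plane) : Submodule ℝ (sobolev k Ω) :=
  (Submodule.span ℝ {U : sobolev k Ω | IsTestElement U}).topologicalClosure

/-- The space `H^k_0(Ω)`, with the norm of `H^k(Ω)`. -/
def HZero (k : ℕ) (Ω : Set Plane) : Type := sobolevZero k Ω

instance (k : ℕ) (Ω : Set Plane) : NormedAddCommGroup (HZero k Ω) :=
  inferInstanceAs (NormedAddCommGroup (sobolevZero k Ω))

instance (k : ℕ) (Ω : Set Plane) : InnerProductSpace ℝ (HZero k Ω) :=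
  inferInstanceAs (InnerProductSpace ℝ (sobolevZero k Ω))

/-- The space `H^1_0(Ω)`. -/
abbrev H10 (Ω : Set Plane) : Type := HZero 1 Ω

/-- The space `H^2_0(Ω)`. -/
abbrev H20 (Ω : Set Plane) : Type := HZero 2 Ω

/-- The inclusion of `H^k_0(Ω)` into `H^k(Ω)`. -/
def inclusion (k : ℕ) (Ω : Set Plane) : HZero k Ω →L[ℝ] sobolev k Ω := (sobolevZero k Ω).subtypeL

/-- The space `H^{-2}(Ω)`, the dual of `H^2_0(Ω)`, with the dual norm. -/
abbrev HNeg2 (Ω : Set Plane) : Type := StrongDual ℝ (H20 Ω)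

/-- The weak derivative `∂^α : H^k_0(Ω) → L²(Ω)`. -/
def weakDeriv {k : ℕ} (Ω : Set Plane) (α : MultiIndex k) : HZero k Ω →L[ℝ] L2 Ω :=
  (PiLp.proj 2 (fun _ : MultiIndex k => L2 Ω) α).comp
    ((sobolev k Ω).subtypeL.comp (inclusion k Ω))

/-- The underlying function, `H^k_0(Ω) → L²(Ω)`. -/
def toL2 {k : ℕ} (Ω : Set Plane) : HZero k Ω →L[ℝ] L2 Ω := weakDeriv Ω (zeroIdx k)

/-- The norm `‖∇v‖_{L²(Ω)}` of `v ∈ H^1_0(Ω)`. -/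
def gradNorm {Ω : Set Plane} (v : H10 Ω) : ℝ :=
  Real.sqrt (∑ i : Fin 2, ‖weakDeriv Ω (firstIdx i) v‖ ^ 2)

/-- The Laplacian `Δ : H^2_0(Ω) → L²(Ω)`. -/
def laplacian (Ω : Set Plane) : H20 Ω →L[ℝ] L2 Ω :=
  ∑ i : Fin 2, weakDeriv Ω (pureSecondIdx i)

/-- `Δv` as an element of `H^{-2}(Ω)`, that is, the functional `φ ↦ (Δv, φ)_Ω`. -/
def laplacianDual (Ω : Set Plane) : H20 Ω →L[ℝ] HNeg2 Ω :=
  (innerSL ℝ : L2 Ω →L[ℝ] L2 Ω →L[ℝ] ℝ).bilinearComp (laplacian Ω) (toL2 Ω)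

/-! ### The time-dependent problem -/

/-- Lebesgue measure on the time interval `I = (0, T]`. -/
abbrev timeMeasure (T : ℝ) : Measure ℝ := volume.restrict (Ioc 0 T)

/-- The Bochner space `L²(I; E)`. -/
abbrev L2Time (T : ℝ) (E : Type) [NormedAddCommGroup E] : Type := Lp E 2 (timeMeasure T)

/-- `g = ∂_t Δv` weakly in time, for `v ∈ L²(I; H^2_0(Ω))` and `g ∈ L²(I; H^{-2}(Ω))`. The
integrals are Bochner integrals in `H^{-2}(Ω)`. -/
def IsTimeDerivLaplacian {Ω : Set Plane} {T : ℝ} (v : L2Time T (H20 Ω))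
    (g : L2Time T (HNeg2 Ω)) : Prop :=
  ∀ η : ℝ → ℝ, ContDiff ℝ ∞ η → HasCompactSupport η → tsupport η ⊆ Ioo 0 T →
    ∫ t, deriv η t • laplacianDual Ω (v t) ∂timeMeasure T = -∫ t, η t • g t ∂timeMeasure T

/-- The space `𝕏` of all `v ∈ L²(I; H^2_0(Ω))` with `∂_t Δv ∈ L²(I; H^{-2}(Ω))`. -/
def MemX {Ω : Set Plane} {T : ℝ} (v : L2Time T (H20 Ω)) : Prop :=
  ∃ g : L2Time T (HNeg2 Ω), IsTimeDerivLaplacian v g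

/-- `w ∈ C([0,T]; H^1_0(Ω))` is a representative of `v`: for a.e. `t ∈ I`, `w(t)` and `v(t)` are
the same function on `Ω`. -/
def IsContRep {Ω : Set Plane} {T : ℝ} (v : L2Time T (H20 Ω))
    (w : C(Icc (0 : ℝ) T, H10 Ω)) : Prop :=
  ∀ᵐ t ∂timeMeasure T, ∀ ht : t ∈ Icc (0 : ℝ) T, toL2 Ω (w ⟨t, ht⟩) = toL2 Ω (v t)

/-- `v(0) = v₀`, for the representative of `v` in `C([0,T]; H^1_0(Ω))`. -/
def HasInitialValue {Ω : Set Plane} {T : ℝ} (v : L2Time T (H20 Ω)) (v₀ : H10 Ω) : Prop :=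
  ∃ w : C(Icc (0 : ℝ) T, H10 Ω), IsContRep v w ∧
    ∃ h0 : (0 : ℝ) ∈ Icc (0 : ℝ) T, w ⟨0, h0⟩ = v₀

/-- `ψ ∈ 𝕏` solves `-⟨∂_t Δψ, φ⟩ + (Δψ, Δφ)_{I×Ω} = ⟨f, φ⟩` for all `φ ∈ L²(I; H^2_0(Ω))`, and
`ψ(0) = ψ₀`. -/
structure IsWeakSolution {Ω : Set Plane} {T : ℝ} (f : L2Time T (HNeg2 Ω)) (ψ₀ : H10 Ω)
    (ψ : L2Time T (H20 Ω)) : Prop where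
  equation : ∃ g : L2Time T (HNeg2 Ω), IsTimeDerivLaplacian ψ g ∧
    ∀ φ : L2Time T (H20 Ω),
      -(∫ t, g t (φ t) ∂timeMeasure T)
        + ∫ t, inner ℝ (laplacian Ω (ψ t)) (laplacian Ω (φ t)) ∂timeMeasure T
      = ∫ t, f t (φ t) ∂timeMeasure T
  initial : HasInitialValue ψ ψ₀

end Biharm

end

/-!
# Well-posedness of the evolution problem `-∂ₜ Δψ + Δ²ψ = f` with clamped boundary conditions

Put `V = H^2_0(Ω)`, `H = H^1_0(Ω)`, let `j : V → L²(Ω)²` be the gradient and let `A : V → V` be the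
operator of the form `(Δu, Δv)`. Green's formula (`laplacianDual_apply`) identifies `-Δ` with
`j† j : V → V`, up to the Riesz isomorphism of `V`, so that the problem is the abstract parabolic
equation `(j† j ψ)' + A ψ = F` in `V`. The form `(Δu, Δv)` is coercive on `V`
(`exists_norm_le_laplacian`), since `Ω` is bounded and the second derivatives of a test function
are controlled by its Laplacian.

By the lemma of du Bois-Reymond (`forall_integral_deriv_smul_iff`) the weak formulation in time is
the integrated equation `j† j ψ(t) + ∫₀ᵗ A ψ = j† ∇ψ₀ + ∫₀ᵗ F` for almost every `t`
(`isWeakSolution_iff`). A solution of it comes from Lions' projection lemma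
(`exists_inner_eq_of_abs_le`, `exists_integrated_solution`), which also bounds `ψ` independently
of `T`. Uniqueness follows by testing with the solution (`ae_eq_zero_of_integrated`).

The representative in `C([0, T]; H)` needs `j† j ψ = k` with `k` continuous in `V` only, and `j† j`
is not invertible on `V`. The functions `(j† j + ε)⁻¹ k` are continuous, and the energy identity for
the forms `‖j S k‖²`, with `S` a difference of two resolvents, shows that they converge uniformly
in `H` as `ε → 0` (`exists_continuous_representative`). The same identity bounds the limit by the
initial value and the `L²` norms of `ψ` and of the derivative.

All of this rests on one integration by parts for primitives of integrable functions,
`integral_primitive_bilin_add`, a consequence of Fubini's theorem.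
-/

noncomputable section

namespace Biharm

/-! ### Functions of time -/

section Time

variable {E F W : Type*} [NormedAddCommGroup E] [NormedSpace ℝ E] [CompleteSpace E]
  [NormedAddCommGroup F] [NormedSpace ℝ F] [CompleteSpace F]
  [NormedAddCommGroup W] [NormedSpace ℝ W] [CompleteSpace W]

/-- Integration by parts for the primitives of two integrable functions: both integrals on the left
are, by Fubini, integrals of `B (f s) (g t)` over one of the two triangles of the square. -/
theorem integral_primitive_bilin_add {T : ℝ} (B : E →L[ℝ] F →L[ℝ] W) {f : ℝ → E}
    {g : ℝ → F} (hf : Integrable f (timeMeasure T)) (hg : Integrable g (timeMeasure T)) :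
    (∫ t, B (∫ s in (0 : ℝ)..t, f s) (g t) ∂timeMeasure T)
      + ∫ t, B (f t) (∫ s in (0 : ℝ)..t, g s) ∂timeMeasure T
      = B (∫ t, f t ∂timeMeasure T) (∫ t, g t ∂timeMeasure T) := by
  set μ := timeMeasure T with hμ
  have hΦ : Integrable (fun p : ℝ × ℝ => B (f p.1) (g p.2)) (μ.prod μ) :=
    hf.op_fst_snd (by fun_prop) ⟨‖B‖, B.le_opNorm₂⟩ hg
  have hA : MeasurableSet {p : ℝ × ℝ | p.1 ≤ p.2} :=
    measurableSet_le measurable_fst measurable_snd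
  rw [← integral_prod_bilin B hf hg, ← integral_add_compl hA hΦ, ← integral_indicator hA,
    ← integral_indicator hA.compl, integral_prod_symm _ (hΦ.indicator hA),
    integral_prod _ (hΦ.indicator hA.compl)]
  congr 1
  · refine setIntegral_congr_fun measurableSet_Ioc fun t ht => ?_
    have h1 : ∫ s in (0 : ℝ)..t, f s = ∫ s in Iic t, f s ∂μ := by
      rw [intervalIntegral.integral_of_le ht.1.le, hμ, Measure.restrict_restrict measurableSet_Iic,
        Iic_inter_Ioc_of_le ht.2]
    change B (∫ s in (0 : ℝ)..t, f s) (g t) = _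
    rw [h1, ← ContinuousLinearMap.flip_apply,
      ← ContinuousLinearMap.integral_comp_comm _ hf.integrableOn,
      ← integral_indicator measurableSet_Iic]
    refine integral_congr_ae (ae_of_all _ fun s => ?_)
    by_cases h : s ≤ t <;> simp [indicator, h]
  · refine setIntegral_congr_fun measurableSet_Ioc fun t ht => ?_
    have h1 : ∫ s in (0 : ℝ)..t, g s = ∫ s in Iio t, g s ∂μ := by
      rw [intervalIntegral.integral_of_le ht.1.le, hμ, Measure.restrict_restrict measurableSet_Iio,
        integral_Ioc_eq_integral_Ioo]
      congr 2
      ext s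
      constructor
      · exact fun h => ⟨h.2, h.1, h.2.le.trans ht.2⟩
      · exact fun h => ⟨h.2.1, h.1⟩
    change B (f t) (∫ s in (0 : ℝ)..t, g s) = _
    rw [h1, ← ContinuousLinearMap.integral_comp_comm _ hg.integrableOn,
      ← integral_indicator measurableSet_Iio]
    refine integral_congr_ae (ae_of_all _ fun s => ?_)
    by_cases h : s < t <;> simp [indicator, h]

end Time

theorem continuousOn_primitive {E : Type*} [NormedAddCommGroup E] [NormedSpace ℝ E]
    {T : ℝ} {f : ℝ → E} (hf : Integrable f (timeMeasure T)) :
    ContinuousOn (fun t => ∫ s in (0 : ℝ)..t, f s) (Icc 0 T) :=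
  intervalIntegral.continuousOn_primitive (by rwa [integrableOn_Icc_iff_integrableOn_Ioc]) |>.congr
    fun t ht => intervalIntegral.integral_of_le ht.1

theorem memLp_of_continuousOn {E : Type*} [NormedAddCommGroup E] {T : ℝ} {f : ℝ → E}
    (hf : ContinuousOn f (Icc 0 T)) (p : ℝ≥0∞) :
    MemLp f p (timeMeasure T) := by
  obtain ⟨C, hC⟩ := isCompact_Icc.exists_bound_of_continuousOn hf
  refine MemLp.of_bound ((hf.mono Ioc_subset_Icc_self).aestronglyMeasurable measurableSet_Ioc) C ?_
  exact (ae_restrict_iff' measurableSet_Ioc).2 (ae_of_all _ fun t ht => hC t ⟨ht.1.le, ht.2⟩)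

section Time

variable {E : Type*} [NormedAddCommGroup E] [NormedSpace ℝ E] [CompleteSpace E]

/-- The fundamental lemma of du Bois-Reymond: a function of time with vanishing weak derivative is
constant. Every test function is a multiple of a fixed one of integral `1`, up to the derivative of
a test function. -/
theorem ae_eq_const_of_integral_deriv_smul {T : ℝ} (hT : 0 < T) {v : ℝ → E}
    (hv : Integrable v (timeMeasure T))
    (h : ∀ η : ℝ → ℝ, ContDiff ℝ ∞ η → HasCompactSupport η → tsupport η ⊆ Ioo 0 T →
      ∫ t, deriv η t • v t ∂timeMeasure T = 0) :
    ∃ c : E, ∀ᵐ t ∂timeMeasure T, v t = c := by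
  let b : ContDiffBump (T / 2) := ⟨T / 8, T / 4, by positivity, by linarith⟩
  set η₀ : ℝ → ℝ := b.normed volume with hη₀
  have hη₀s : ContDiff ℝ ∞ η₀ := b.contDiff_normed
  have hη₀c : HasCompactSupport η₀ := b.hasCompactSupport_normed
  have hη₀t : tsupport η₀ = Metric.closedBall (T / 2) (T / 4) := b.tsupport_normed_eq
  refine ⟨∫ t, η₀ t • v t ∂timeMeasure T, ?_⟩
  set c := ∫ t, η₀ t • v t ∂timeMeasure T with hc
  have hint : ∀ ζ : ℝ → ℝ, Continuous ζ → Integrable (fun t => ζ t • v t) (timeMeasure T) := by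
    intro ζ hζ
    obtain ⟨C, hC⟩ := isCompact_Icc.exists_bound_of_continuousOn (hζ.continuousOn (s := Icc 0 T))
    refine hv.bdd_smul C hζ.aestronglyMeasurable ?_
    exact (ae_restrict_iff' measurableSet_Ioc).2 (ae_of_all _ fun t ht => hC t ⟨ht.1.le, ht.2⟩)
  have key : ∀ᵐ t, t ∈ Ioo 0 T → v t - c = 0 := by
    refine isOpen_Ioo.ae_eq_zero_of_integral_contDiff_smul_eq_zero ?_ ?_
    · have h1 : IntegrableOn v (Ioo 0 T) := IntegrableOn.mono_set hv Ioo_subset_Ioc_self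
      exact (h1.sub (integrableOn_const (by simp))).locallyIntegrableOn
    intro ζ hζs hζc hζt
    set m := ∫ t, ζ t with hm
    set θ : ℝ → ℝ := fun t => ζ t - m * η₀ t with hθ
    have hθs : ContDiff ℝ ∞ θ := hζs.sub (contDiff_const.mul hη₀s)
    set K := tsupport ζ ∪ tsupport η₀ with hK
    have hKc : IsCompact K := hζc.isCompact.union hη₀c.isCompact
    have hKn : K.Nonempty := ⟨T / 2, Or.inr (by rw [hη₀t]; simp; positivity)⟩
    have hKI : K ⊆ Ioo 0 T := by
      refine union_subset hζt ?_
      rw [hη₀t, Real.closedBall_eq_Icc]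
      intro t ht
      exact ⟨by linarith [ht.1], by linarith [ht.2]⟩
    obtain ⟨a, haK, ha⟩ := hKc.exists_isLeast hKn
    obtain ⟨d, hdK, hd⟩ := hKc.exists_isGreatest hKn
    have hz : ∀ t, t ∉ K → ζ t = 0 ∧ η₀ t = 0 := fun t ht =>
      ⟨image_eq_zero_of_notMem_tsupport fun h => ht (Or.inl h),
        image_eq_zero_of_notMem_tsupport fun h => ht (Or.inr h)⟩
    have hθ0 : ∀ t, t ∉ K → θ t = 0 := fun t ht => by simp [hθ, hz t ht]
    have hθi : ∫ t, θ t = 0 := by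
      rw [hθ, integral_sub (hζs.continuous.integrable_of_hasCompactSupport hζc)
        ((hη₀s.continuous.integrable_of_hasCompactSupport hη₀c).const_mul m),
        integral_const_mul, hη₀, b.integral_normed, mul_one, sub_self]
    set η : ℝ → ℝ := fun t => ∫ s in (0 : ℝ)..t, θ s with hη
    have hη' : ∀ t, HasDerivAt η (θ t) t := fun t =>
      hθs.continuous.integral_hasStrictDerivAt 0 t |>.hasDerivAt
    have hd' : deriv η = θ := funext fun t => (hη' t).deriv
    have hηs : ContDiff ℝ ∞ η := by
      rw [contDiff_infty_iff_deriv]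
      exact ⟨fun t => (hη' t).differentiableAt, hd' ▸ hθs⟩
    have hη0 : ∀ t, t ∉ Icc a d → η t = 0 := by
      intro t ht
      by_cases hta : t < a
      · refine intervalIntegral.integral_zero_ae (ae_of_all _ fun s hs => hθ0 s fun hsK => ?_)
        have h1 := hs.2
        have h2 := ha hsK
        have h3 : s < a := h1.trans_lt (max_lt (hKI haK).1 hta)
        linarith
      · have htd : d < t := by by_contra h; exact ht ⟨not_lt.1 hta, not_lt.1 h⟩
        have h1 : ∫ s in (0 : ℝ)..t, θ s = ∫ s, θ s := by
          refine intervalIntegral.integral_eq_integral_of_support_subset fun s hs => ?_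
          have hsK : s ∈ K := by by_contra h; exact hs (hθ0 s h)
          exact ⟨(hKI hsK).1, (hd hsK).trans htd.le⟩
        rw [hη]; simp only; rw [h1, hθi]
    have hηt : tsupport η ⊆ Icc a d :=
      closure_minimal (fun t ht => by by_contra h; exact ht (hη0 t h)) isClosed_Icc
    have h1 := h η hηs (HasCompactSupport.of_support_subset_isCompact isCompact_Icc
      ((subset_tsupport η).trans hηt)) (hηt.trans fun t ht =>
        ⟨(hKI haK).1.trans_le ht.1, ht.2.trans_lt (hKI hdK).2⟩)
    rw [hd'] at h1
    have h2 : ∫ t, θ t • v t ∂timeMeasure T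
        = (∫ t, ζ t • v t ∂timeMeasure T) - m • c := by
      have h3 : Integrable (fun t => m • η₀ t • v t) (timeMeasure T) :=
        (hint η₀ hη₀s.continuous).smul m
      rw [hc, ← integral_smul, ← integral_sub (hint ζ hζs.continuous) h3]
      refine integral_congr_ae (ae_of_all _ fun t => ?_)
      simp [hθ, sub_smul, mul_smul]
    have h3 : ∫ t, ζ t • (v t - c) = ∫ t, ζ t • (v t - c) ∂timeMeasure T := by
      refine (setIntegral_eq_integral_of_forall_compl_eq_zero fun t ht => ?_).symm
      have : ζ t = 0 := (hz t fun hK => ht (Ioo_subset_Ioc_self (hKI hK))).1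
      simp [this]
    have h4 : ∫ t, ζ t ∂timeMeasure T = m := by
      refine setIntegral_eq_integral_of_forall_compl_eq_zero fun t ht => ?_
      exact (hz t fun hK => ht (Ioo_subset_Ioc_self (hKI hK))).1
    have h5 : Integrable ζ (timeMeasure T) :=
      (hζs.continuous.integrable_of_hasCompactSupport hζc).integrableOn
    rw [h3]
    simp_rw [smul_sub]
    rw [integral_sub (hint ζ hζs.continuous) (h5.smul_const c), integral_smul_const, h4, ← h2, h1]
  have : ∀ᵐ t ∂timeMeasure T, t ∈ Ioo 0 T := by
    rw [timeMeasure, ← Measure.restrict_congr_set Ioo_ae_eq_Ioc]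
    exact ae_restrict_mem measurableSet_Ioo
  filter_upwards [this, ae_restrict_of_ae key] with t ht hk
  exact sub_eq_zero.1 (hk ht)

/-- The weak formulation of `k' = g` on `(0, T)` says that `k` is a primitive of `g`. -/
theorem forall_integral_deriv_smul_iff {T : ℝ} (hT : 0 < T) {k g : ℝ → E}
    (hk : Integrable k (timeMeasure T)) (hg : Integrable g (timeMeasure T)) :
    (∀ η : ℝ → ℝ, ContDiff ℝ ∞ η → HasCompactSupport η → tsupport η ⊆ Ioo 0 T →
      ∫ t, deriv η t • k t ∂timeMeasure T = -∫ t, η t • g t ∂timeMeasure T) ↔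
    ∃ c : E, ∀ᵐ t ∂timeMeasure T, k t = c + ∫ s in (0 : ℝ)..t, g s := by
  have hp : Integrable (fun t => ∫ s in (0 : ℝ)..t, g s) (timeMeasure T) :=
    memLp_one_iff_integrable.1 (memLp_of_continuousOn (continuousOn_primitive hg) 1)
  have hbd : ∀ ζ : ℝ → ℝ, Continuous ζ → ∀ v : ℝ → E, Integrable v (timeMeasure T) →
      Integrable (fun t => ζ t • v t) (timeMeasure T) := by
    intro ζ hζ v hv
    obtain ⟨C, hC⟩ := isCompact_Icc.exists_bound_of_continuousOn (hζ.continuousOn (s := Icc 0 T))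
    refine hv.bdd_smul C hζ.aestronglyMeasurable ?_
    exact (ae_restrict_iff' measurableSet_Ioc).2 (ae_of_all _ fun t ht => hC t ⟨ht.1.le, ht.2⟩)
  have hftc : ∀ η : ℝ → ℝ, ContDiff ℝ ∞ η → tsupport η ⊆ Ioo 0 T →
      ∀ t, ∫ s in (0 : ℝ)..t, deriv η s = η t := by
    intro η hη ht t
    have h0 : η 0 = 0 := image_eq_zero_of_notMem_tsupport fun h => (ht h).1.false
    rw [intervalIntegral.integral_deriv_eq_sub
      (fun s _ => (hη.differentiable (by simp)).differentiableAt)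
      ((hη.continuous_deriv (by simp)).intervalIntegrable _ _), h0, sub_zero]
  have hibp : ∀ η : ℝ → ℝ, ContDiff ℝ ∞ η → tsupport η ⊆ Ioo 0 T →
      ∫ t, deriv η t • (∫ s in (0 : ℝ)..t, g s) ∂timeMeasure T
        = -∫ t, η t • g t ∂timeMeasure T := by
    intro η hη ht
    have hd : Continuous (deriv η) := hη.continuous_deriv (by simp)
    have h1 := integral_primitive_bilin_add (ContinuousLinearMap.lsmul ℝ ℝ : ℝ →L[ℝ] E →L[ℝ] E)
      (memLp_one_iff_integrable.1 (memLp_of_continuousOn (T := T) hd.continuousOn 1)) hg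
    have hT0 : η T = 0 := image_eq_zero_of_notMem_tsupport fun h => (ht h).2.false
    simp only [ContinuousLinearMap.lsmul_apply, hftc η hη ht] at h1
    have h2 : ∫ s, deriv η s ∂timeMeasure T = 0 := by
      rw [← intervalIntegral.integral_of_le hT.le, hftc η hη ht, hT0]
    rw [h2, zero_smul] at h1
    exact eq_neg_of_add_eq_zero_right h1
  constructor
  · intro h
    obtain ⟨c, hc⟩ := ae_eq_const_of_integral_deriv_smul hT (hk.sub hp) fun η hη hηc hηt => by
      have hd : Continuous (deriv η) := hη.continuous_deriv (by simp)
      simp only [Pi.sub_apply, smul_sub]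
      rw [integral_sub (hbd _ hd _ hk) (hbd _ hd _ hp), h η hη hηc hηt, hibp η hη hηt, sub_self]
    exact ⟨c, hc.mono fun t ht => sub_eq_iff_eq_add.1 ht⟩
  · rintro ⟨c, hc⟩ η hη hηc hηt
    have hd : Continuous (deriv η) := hη.continuous_deriv (by simp)
    have hT0 : η T = 0 := image_eq_zero_of_notMem_tsupport fun h => (hηt h).2.false
    have h1 : ∫ t, deriv η t ∂timeMeasure T = 0 := by
      rw [← intervalIntegral.integral_of_le hT.le, hftc η hη hηt, hT0]
    have h2 : ∫ t, deriv η t • k t ∂timeMeasure T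
        = ∫ t, (deriv η t • c + deriv η t • ∫ s in (0 : ℝ)..t, g s) ∂timeMeasure T :=
      integral_congr_ae (hc.mono fun t ht => by simp only [ht, smul_add])
    have h3 : Integrable (deriv η) (timeMeasure T) :=
      memLp_one_iff_integrable.1 (memLp_of_continuousOn (T := T) hd.continuousOn 1)
    rw [h2, integral_add (h3.smul_const c) (hbd _ hd _ hp), integral_smul_const, h1, zero_smul,
      zero_add, hibp η hη hηt]

end Time

/-! ### Lions' projection lemma -/

/-- Lions' projection lemma: a linear functional `ℓ` on `M` which is bounded by `C ‖S h‖` is of the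
form `⟪u, S h⟫` with `‖u‖ ≤ C`. -/
theorem exists_inner_eq_of_abs_le {M X : Type*} [AddCommGroup M] [Module ℝ M]
    [NormedAddCommGroup X] [InnerProductSpace ℝ X] [CompleteSpace X] (S : M →ₗ[ℝ] X)
    (ℓ : M →ₗ[ℝ] ℝ) {C : ℝ} (hC : 0 ≤ C) (h : ∀ m, |ℓ m| ≤ C * ‖S m‖) :
    ∃ u : X, ‖u‖ ≤ C ∧ ∀ m, inner ℝ u (S m) = ℓ m := by
  have hker : S.ker ≤ ℓ.ker := fun m hm => by
    have h1 := h m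
    rw [LinearMap.mem_ker.1 hm, norm_zero, mul_zero] at h1
    exact LinearMap.mem_ker.2 (abs_nonpos_iff.1 h1)
  let f₀ : S.range →ₗ[ℝ] ℝ := (S.ker.liftQ ℓ hker) ∘ₗ S.quotKerEquivRange.symm.toLinearMap
  have hf₀ : ∀ m, f₀ ⟨S m, LinearMap.mem_range_self S m⟩ = ℓ m := fun m => by
    have h1 : S.quotKerEquivRange.symm ⟨S m, LinearMap.mem_range_self S m⟩ = S.ker.mkQ m := by
      rw [LinearEquiv.symm_apply_eq]
      exact Subtype.ext (by simp)
    change (S.ker.liftQ ℓ hker) (S.quotKerEquivRange.symm _) = _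
    rw [h1]
    simp
  let f : StrongDual ℝ S.range := f₀.mkContinuous C fun x => by
    obtain ⟨_, m, rfl⟩ := x
    rw [hf₀]
    exact h m
  obtain ⟨F, hF, hFn⟩ := exists_extension_norm_eq S.range f
  refine ⟨(InnerProductSpace.toDual ℝ X).symm F, ?_, fun m => ?_⟩
  · rw [LinearIsometryEquiv.norm_map, hFn]
    exact f₀.mkContinuous_norm_le hC _
  · rw [InnerProductSpace.toDual_symm_apply]
    exact (hF ⟨S m, LinearMap.mem_range_self S m⟩).trans (hf₀ m)

/-! ### Energy identities -/

section Energy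

theorem integrable_inner_primitive {X : Type*} [NormedAddCommGroup X] [InnerProductSpace ℝ X]
    {T : ℝ} {f g : ℝ → X}
    (hf : Integrable f (timeMeasure T)) (hg : Integrable g (timeMeasure T)) :
    Integrable (fun t => inner ℝ (f t) (∫ s in (0 : ℝ)..t, g s)) (timeMeasure T) := by
  have hp : MemLp (fun t => ∫ s in (0 : ℝ)..t, g s) ∞ (timeMeasure T) :=
    memLp_of_continuousOn (continuousOn_primitive hg) ∞
  refine memLp_one_iff_integrable.1 <| MemLp.of_bilin (fun a b => inner ℝ a b) 1
      (memLp_one_iff_integrable.2 hf) hp (hf.1.inner hp.1) (ae_of_all _ fun s => ?_)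
  rw [one_mul]
  exact norm_inner_le_norm (𝕜 := ℝ) _ _

variable {X : Type*} [NormedAddCommGroup X] [InnerProductSpace ℝ X] [CompleteSpace X]

theorem integral_inner_primitive_add {T : ℝ} {f g : ℝ → X}
    (hf : Integrable f (timeMeasure T)) (hg : Integrable g (timeMeasure T)) :
    (∫ t, inner ℝ (∫ s in (0 : ℝ)..t, f s) (g t) ∂timeMeasure T)
      + ∫ t, inner ℝ (f t) (∫ s in (0 : ℝ)..t, g s) ∂timeMeasure T
      = inner ℝ (∫ t, f t ∂timeMeasure T) (∫ t, g t ∂timeMeasure T) :=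
  integral_primitive_bilin_add (innerSL ℝ : X →L[ℝ] X →L[ℝ] ℝ) hf hg

/-- The energy identity `d/dt ‖p‖² = 2 ⟪p, p'⟫` for `p t = x + ∫₀ᵗ q`. -/
theorem norm_sq_add_primitive {t : ℝ} (ht : 0 ≤ t) (x : X) {q : ℝ → X}
    (hq : Integrable q (timeMeasure t)) :
    ‖x + ∫ s in (0 : ℝ)..t, q s‖ ^ 2
      = ‖x‖ ^ 2 + 2 * ∫ s, inner ℝ (x + ∫ r in (0 : ℝ)..s, q r) (q s) ∂timeMeasure t := by
  have h1 := integral_inner_primitive_add hq hq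
  have h2 : ∫ s, inner ℝ (q s) (∫ r in (0 : ℝ)..s, q r) ∂timeMeasure t
      = ∫ s, inner ℝ (∫ r in (0 : ℝ)..s, q r) (q s) ∂timeMeasure t :=
    integral_congr_ae (ae_of_all _ fun s => real_inner_comm _ _)
  have h3 : Integrable (fun s => inner ℝ (∫ r in (0 : ℝ)..s, q r) (q s)) (timeMeasure t) :=
    (integrable_inner_primitive hq hq).congr (ae_of_all _ fun s => real_inner_comm _ _)
  have h4 : Integrable (fun s => inner ℝ x (q s)) (timeMeasure t) := hq.const_inner x
  simp_rw [inner_add_left]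
  rw [integral_add h4 h3, integral_inner hq, intervalIntegral.integral_of_le ht,
    norm_add_sq_real]
  rw [h2, real_inner_self_eq_norm_sq] at h1
  linarith

/-- `∫ ⟪q t, ∫ₜᵀ h⟫ = ∫ ⟪∫₀ᵗ q, h t⟫`. -/
theorem integral_inner_backward {T : ℝ} (hT : 0 ≤ T) {q h : ℝ → X}
    (hq : Integrable q (timeMeasure T)) (hh : Continuous h) :
    ∫ t, inner ℝ (q t) (∫ s in t..T, h s) ∂timeMeasure T
      = ∫ t, inner ℝ (∫ s in (0 : ℝ)..t, q s) (h t) ∂timeMeasure T := by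
  have hhi : Integrable h (timeMeasure T) :=
    memLp_one_iff_integrable.1 (memLp_of_continuousOn (T := T) hh.continuousOn 1)
  have h1 := integral_inner_primitive_add hq hhi
  have h3 := integrable_inner_primitive hq hhi
  have h4 : ∀ t, ∫ s in t..T, h s = (∫ s in (0 : ℝ)..T, h s) - ∫ s in (0 : ℝ)..t, h s := fun t =>
    (intervalIntegral.integral_interval_sub_left (hh.intervalIntegrable _ _)
      (hh.intervalIntegrable _ _)).symm
  have h6 : ∀ t, inner ℝ (q t) (∫ s in t..T, h s) = inner ℝ (q t) (∫ s in (0 : ℝ)..T, h s)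
      - inner ℝ (q t) (∫ s in (0 : ℝ)..t, h s) := fun t => by rw [h4 t, inner_sub_right]
  rw [integral_congr_ae (ae_of_all _ h6), integral_sub (hq.inner_const _) h3]
  have h5 : ∫ t, inner ℝ (q t) (∫ s in (0 : ℝ)..T, h s) ∂timeMeasure T
      = inner ℝ (∫ t, q t ∂timeMeasure T) (∫ s in (0 : ℝ)..T, h s) := by
    rw [real_inner_comm, ← integral_inner hq]
    exact integral_congr_ae (ae_of_all _ fun t => real_inner_comm _ _)
  rw [h5, intervalIntegral.integral_of_le hT]
  linarith

/-- Continuous functions of time as elements of `L²(I; X)`. -/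
def contToLp (X : Type*) [NormedAddCommGroup X] [InnerProductSpace ℝ X] (T : ℝ) :
    C(ℝ, X) →ₗ[ℝ] Lp X 2 (timeMeasure T) where
  toFun h := (memLp_of_continuousOn (T := T) h.continuous.continuousOn 2).toLp h
  map_add' _ _ := rfl
  map_smul' _ _ := rfl

theorem coeFn_contToLp {X : Type*} [NormedAddCommGroup X] [InnerProductSpace ℝ X] (T : ℝ)
    (h : C(ℝ, X)) : contToLp X T h =ᵐ[timeMeasure T] h :=
  (memLp_of_continuousOn (T := T) h.continuous.continuousOn 2).coeFn_toLp

/-- The primitive `t ↦ ∫ₜᵀ h`, which vanishes at the final time. -/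
def backwardPrimitive (X : Type*) [NormedAddCommGroup X] [InnerProductSpace ℝ X] (T : ℝ) :
    C(ℝ, X) →ₗ[ℝ] C(ℝ, X) where
  toFun h := ⟨fun t => ∫ s in t..T, h s, by
    refine Continuous.congr ?_ fun t => (intervalIntegral.integral_symm T t).symm
    exact (intervalIntegral.continuous_primitive
      (fun a b => h.continuous.intervalIntegrable a b) T).neg⟩
  map_add' f g := by
    ext t
    exact intervalIntegral.integral_add (f.continuous.intervalIntegrable _ _)
      (g.continuous.intervalIntegrable _ _)
  map_smul' c f := by
    ext t
    exact intervalIntegral.integral_smul c f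

end Energy

/-! ### Existence and uniqueness for an abstract parabolic equation -/

section Parabolic

variable {V G : Type*} [NormedAddCommGroup V] [InnerProductSpace ℝ V] [CompleteSpace V]
  [NormedAddCommGroup G] [InnerProductSpace ℝ G] [CompleteSpace G]

/-- Existence for `(j† j u)' + A u = F`, `j† j u(0) = j† u₀`, in integrated form. Lions' projection
lemma is applied to the operator `h ↦ A φ + j† j h` on continuous functions, where `φ t = ∫ₜᵀ h`;
testing with `φ` shows that it bounds `‖φ‖` and `‖j (φ 0)‖`. -/
theorem exists_integrated_solution {T : ℝ} (hT : 0 < T) (j : V →L[ℝ] G) (A : V →L[ℝ] V)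
    (hA : ∀ x y, inner ℝ (A x) y = inner ℝ x (A y)) {c : ℝ} (hc : 0 < c)
    (hcA : ∀ x, c * ‖x‖ ^ 2 ≤ inner ℝ (A x) x) (F : Lp V 2 (timeMeasure T)) (u₀ : G) :
    ∃ u : Lp V 2 (timeMeasure T), ‖u‖ ≤ c⁻¹ * ‖F‖ + Real.sqrt (2 / c) * ‖u₀‖ ∧
      ∀ᵐ t ∂timeMeasure T, j.adjoint (j (u t)) + ∫ s in (0 : ℝ)..t, A (u s)
        = j.adjoint u₀ + ∫ s in (0 : ℝ)..t, F s := by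
  set K : V →L[ℝ] V := j.adjoint ∘L j
  have hKx : ∀ x, K x = j.adjoint (j x) := fun x => rfl
  let P := backwardPrimitive V T
  have hP : ∀ h t, P h t = ∫ s in t..T, h s := fun h t => rfl
  let S₀ : C(ℝ, V) →ₗ[ℝ] C(ℝ, V) :=
    (A.compLeftContinuous ℝ ℝ : C(ℝ, V) →ₗ[ℝ] C(ℝ, V)) ∘ₗ P
      + (K.compLeftContinuous ℝ ℝ : C(ℝ, V) →ₗ[ℝ] C(ℝ, V))
  have hS₀ : ∀ h t, S₀ h t = A (P h t) + K (h t) := fun h t => rfl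
  let S : C(ℝ, V) →ₗ[ℝ] Lp V 2 (timeMeasure T) := contToLp V T ∘ₗ S₀
  let δ : C(ℝ, V) →ₗ[ℝ] G :=
    { toFun := fun h => j (P h 0)
      map_add' := fun f g => by rw [map_add, ContinuousMap.add_apply, map_add]
      map_smul' := fun a f => by
        rw [map_smul, ContinuousMap.smul_apply, map_smul, RingHom.id_apply] }
  let ℓ : C(ℝ, V) →ₗ[ℝ] ℝ :=
    (innerSL ℝ F).toLinearMap ∘ₗ contToLp V T ∘ₗ P + (innerSL ℝ u₀).toLinearMap ∘ₗ δ
  have hℓ : ∀ h, ℓ h = inner ℝ F (contToLp V T (P h)) + inner ℝ u₀ (j (P h 0)) := fun h => rfl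
  have hint : ∀ h : C(ℝ, V), Integrable h (timeMeasure T) := fun h =>
    memLp_one_iff_integrable.1 (memLp_of_continuousOn (T := T) h.continuous.continuousOn 1)
  -- testing with `φ = P h`
  have hcoer : ∀ h, c * ‖contToLp V T (P h)‖ ^ 2 + ‖j (P h 0)‖ ^ 2 / 2
      ≤ ‖contToLp V T (P h)‖ * ‖S h‖ := by
    intro h
    have hjc : Continuous fun t => j (h t) := j.continuous.comp h.continuous
    have hji : Integrable (fun t => j (h t)) (timeMeasure T) := j.integrable_comp (hint h)
    have e1 : ∫ t, inner ℝ (K (h t)) (P h t) ∂timeMeasure T = ‖j (P h 0)‖ ^ 2 / 2 := by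
      have f1 := norm_sq_add_primitive hT.le (0 : G) hji
      simp only [zero_add, norm_zero] at f1
      have f2 := integral_inner_backward hT.le hji hjc
      have f3 : ∀ t, inner ℝ (K (h t)) (P h t) = inner ℝ (j (h t)) (∫ s in t..T, j (h s)) := by
        intro t
        rw [hKx, ContinuousLinearMap.adjoint_inner_left, hP,
          j.intervalIntegral_comp_comm (h.continuous.intervalIntegrable _ _)]
      have f4 : j (P h 0) = ∫ s in (0 : ℝ)..T, j (h s) := by
        rw [hP, j.intervalIntegral_comp_comm (h.continuous.intervalIntegrable _ _)]
      simp_rw [f3]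
      rw [f2, f4, f1]
      ring
    have e2 : inner ℝ (S h) (contToLp V T (P h))
        = ∫ t, inner ℝ (S₀ h t) (P h t) ∂timeMeasure T := by
      rw [L2.inner_def]
      refine integral_congr_ae ?_
      filter_upwards [coeFn_contToLp T (S₀ h), coeFn_contToLp T (P h)] with t h1 h2
      rw [h2]
      exact congrArg (fun x => inner ℝ x _) h1
    have e3 : ‖contToLp V T (P h)‖ ^ 2 = ∫ t, ‖P h t‖ ^ 2 ∂timeMeasure T := by
      rw [← real_inner_self_eq_norm_sq, L2.inner_def]
      refine integral_congr_ae ?_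
      filter_upwards [coeFn_contToLp T (P h)] with t h2
      rw [h2, real_inner_self_eq_norm_sq]
    have i1 : Integrable (fun t => inner ℝ (A (P h t)) (P h t)) (timeMeasure T) :=
      memLp_one_iff_integrable.1 (memLp_of_continuousOn (T := T)
        (Continuous.continuousOn (by fun_prop)) 1)
    have i2 : Integrable (fun t => inner ℝ (K (h t)) (P h t)) (timeMeasure T) :=
      memLp_one_iff_integrable.1 (memLp_of_continuousOn (T := T)
        (Continuous.continuousOn (by fun_prop)) 1)
    have i3 : Integrable (fun t => ‖P h t‖ ^ 2) (timeMeasure T) :=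
      memLp_one_iff_integrable.1 (memLp_of_continuousOn (T := T)
        (Continuous.continuousOn (by fun_prop)) 1)
    have e4 : ∫ t, inner ℝ (S₀ h t) (P h t) ∂timeMeasure T
        = (∫ t, inner ℝ (A (P h t)) (P h t) ∂timeMeasure T) + ‖j (P h 0)‖ ^ 2 / 2 := by
      rw [← e1, ← integral_add i1 i2]
      simp_rw [hS₀, inner_add_left]
    have e5 : c * ‖contToLp V T (P h)‖ ^ 2 ≤ ∫ t, inner ℝ (A (P h t)) (P h t) ∂timeMeasure T := by
      rw [e3, ← integral_const_mul]
      exact integral_mono (i3.const_mul c) i1 fun t => hcA _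
    have e6 := real_inner_le_norm (S h) (contToLp V T (P h))
    rw [e2, e4] at e6
    linarith
  -- hence `‖φ‖ ≤ c⁻¹ ‖S h‖` and `‖j (φ 0)‖² ≤ 2 ‖φ‖ ‖S h‖ ≤ (2 / c) ‖S h‖²`
  have hbound : ∀ h, |ℓ h| ≤ (c⁻¹ * ‖F‖ + Real.sqrt (2 / c) * ‖u₀‖) * ‖S h‖ := by
    intro h
    have h1 := hcoer h
    set a := ‖contToLp V T (P h)‖
    set b := ‖j (P h 0)‖
    have ha : 0 ≤ a := norm_nonneg _
    have hs : 0 ≤ ‖S h‖ := norm_nonneg _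
    have h2 : a ≤ c⁻¹ * ‖S h‖ := by
      rw [← div_eq_inv_mul, le_div_iff₀ hc]
      rcases ha.eq_or_lt with h0 | h0
      · rw [← h0, zero_mul]; exact hs
      · nlinarith [sq_nonneg b]
    have h3 : b ≤ Real.sqrt (2 / c) * ‖S h‖ := by
      refine (Real.le_sqrt_of_sq_le (y := 2 / c * ‖S h‖ ^ 2) ?_).trans_eq ?_
      · have h4 : a * ‖S h‖ ≤ c⁻¹ * ‖S h‖ * ‖S h‖ := by gcongr
        have h5 : 0 ≤ c * a ^ 2 := by positivity
        calc b ^ 2 ≤ 2 * (c⁻¹ * ‖S h‖ * ‖S h‖) := by linarith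
          _ = 2 / c * ‖S h‖ ^ 2 := by ring
      · rw [Real.sqrt_mul (by positivity), Real.sqrt_sq hs]
    rw [hℓ]
    calc |inner ℝ F (contToLp V T (P h)) + inner ℝ u₀ (j (P h 0))|
        ≤ ‖F‖ * a + ‖u₀‖ * b := (abs_add_le _ _).trans
          (add_le_add (abs_real_inner_le_norm _ _) (abs_real_inner_le_norm _ _))
      _ ≤ ‖F‖ * (c⁻¹ * ‖S h‖) + ‖u₀‖ * (Real.sqrt (2 / c) * ‖S h‖) := by gcongr
      _ = _ := by ring
  obtain ⟨u, hu, hus⟩ := exists_inner_eq_of_abs_le S ℓ (by positivity) hbound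
  refine ⟨u, hu, ?_⟩
  have hui : Integrable u (timeMeasure T) := (Lp.memLp u).integrable (by norm_num)
  have hFi : Integrable F (timeMeasure T) := (Lp.memLp F).integrable (by norm_num)
  have hAi : Integrable (fun t => A (u t)) (timeMeasure T) := A.integrable_comp hui
  set q : ℝ → V := fun t => A (u t) - F t with hq
  have hqi : Integrable q (timeMeasure T) := hAi.sub hFi
  -- the defect of the integrated equation is orthogonal to all continuous functions
  set r : ℝ → V := fun t => K (u t) + (∫ s in (0 : ℝ)..t, q s) - j.adjoint u₀ with hr
  have hpi : Integrable (fun t => ∫ s in (0 : ℝ)..t, q s) (timeMeasure T) :=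
    memLp_one_iff_integrable.1 (memLp_of_continuousOn (continuousOn_primitive hqi) 1)
  have hKi : Integrable (fun t => K (u t)) (timeMeasure T) := K.integrable_comp hui
  have hri : Integrable r (timeMeasure T) := (hKi.add hpi).sub (integrable_const _)
  have hrh : ∀ h : C(ℝ, V), ∫ t, inner ℝ (r t) (h t) ∂timeMeasure T = 0 := by
    intro h
    have bdd : ∀ (p : ℝ → V) (g : C(ℝ, V)), Integrable p (timeMeasure T) →
        Integrable (fun t => inner ℝ (p t) (g t)) (timeMeasure T) := by
      intro p g hp
      have hg : MemLp g ∞ (timeMeasure T) :=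
        memLp_of_continuousOn (T := T) g.continuous.continuousOn ∞
      refine memLp_one_iff_integrable.1 <| MemLp.of_bilin (fun a b => inner ℝ a b) 1
        (memLp_one_iff_integrable.2 hp) hg (hp.1.inner hg.1) (ae_of_all _ fun s => ?_)
      rw [one_mul]
      exact norm_inner_le_norm (𝕜 := ℝ) _ _
    have h1 := hus h
    rw [hℓ, L2.inner_def, L2.inner_def] at h1
    have h2 : ∫ t, inner ℝ (u t) (S h t) ∂timeMeasure T
        = (∫ t, inner ℝ (A (u t)) (P h t) ∂timeMeasure T)
          + ∫ t, inner ℝ (K (u t)) (h t) ∂timeMeasure T := by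
      rw [← integral_add (bdd _ _ hAi) (bdd _ _ hKi)]
      refine integral_congr_ae ?_
      filter_upwards [coeFn_contToLp T (S₀ h)] with t h1
      have h1' : S h t = S₀ h t := h1
      rw [h1', hS₀, inner_add_right, hA, hKx, hKx, ContinuousLinearMap.adjoint_inner_right,
        ContinuousLinearMap.adjoint_inner_left]
    have h3 : ∫ t, inner ℝ (F t) (contToLp V T (P h) t) ∂timeMeasure T
        = ∫ t, inner ℝ (F t) (P h t) ∂timeMeasure T := by
      refine integral_congr_ae ?_
      filter_upwards [coeFn_contToLp T (P h)] with t h1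
      rw [h1]
    have h4 : inner ℝ u₀ (j (P h 0)) = ∫ t, inner ℝ (j.adjoint u₀) (h t) ∂timeMeasure T := by
      rw [integral_inner (hint h), hP, ContinuousLinearMap.adjoint_inner_left,
        intervalIntegral.integral_of_le hT.le]
    have h5 : ∫ t, inner ℝ (q t) (P h t) ∂timeMeasure T
        = (∫ t, inner ℝ (A (u t)) (P h t) ∂timeMeasure T)
          - ∫ t, inner ℝ (F t) (P h t) ∂timeMeasure T := by
      rw [← integral_sub (bdd _ _ hAi) (bdd _ _ hFi)]
      simp_rw [hq, inner_sub_left]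
    have h6 := integral_inner_backward hT.le hqi h.continuous
    have h7 : ∫ t, inner ℝ (r t) (h t) ∂timeMeasure T = (∫ t, inner ℝ (K (u t)) (h t) ∂timeMeasure T)
        + (∫ t, inner ℝ (∫ s in (0 : ℝ)..t, q s) (h t) ∂timeMeasure T)
        - ∫ t, inner ℝ (j.adjoint u₀) (h t) ∂timeMeasure T := by
      have hs : Integrable (fun t => inner ℝ (K (u t)) (h t)
          + inner ℝ (∫ s in (0 : ℝ)..t, q s) (h t)) (timeMeasure T) :=
        (bdd _ _ hKi).add (bdd _ _ hpi)
      rw [← integral_add (bdd _ _ hKi) (bdd _ _ hpi), ← integral_sub hs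
        (bdd _ _ (integrable_const _))]
      simp_rw [hr, inner_sub_left, inner_add_left]
    have h6' : ∫ t, inner ℝ (q t) (P h t) ∂timeMeasure T
      = ∫ t, inner ℝ (∫ s in (0 : ℝ)..t, q s) (h t) ∂timeMeasure T := h6
    rw [h2, h3, h4] at h1
    rw [h7, ← h6', h5]
    linarith
  have key : ∀ᵐ t, t ∈ Ioo 0 T → r t = 0 := by
    refine isOpen_Ioo.ae_eq_zero_of_integral_contDiff_smul_eq_zero
      (IntegrableOn.mono_set hri Ioo_subset_Ioc_self).locallyIntegrableOn ?_
    intro ζ hζs hζc hζt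
    have h1 : ∫ t, ζ t • r t = ∫ t, ζ t • r t ∂timeMeasure T := by
      refine (setIntegral_eq_integral_of_forall_compl_eq_zero fun t ht => ?_).symm
      have : ζ t = 0 := image_eq_zero_of_notMem_tsupport fun h => ht (Ioo_subset_Ioc_self (hζt h))
      rw [this, zero_smul]
    have hi : Integrable (fun t => ζ t • r t) (timeMeasure T) := by
      obtain ⟨C, hC⟩ := isCompact_Icc.exists_bound_of_continuousOn
        (hζs.continuous.continuousOn (s := Icc 0 T))
      refine hri.bdd_smul C hζs.continuous.aestronglyMeasurable ?_
      exact (ae_restrict_iff' measurableSet_Ioc).2 (ae_of_all _ fun t ht => hC t ⟨ht.1.le, ht.2⟩)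
    rw [h1]
    refine ext_inner_left ℝ fun y => ?_
    rw [← integral_inner hi, inner_zero_right]
    have h2 := hrh ⟨fun t => ζ t • y, by have := hζs.continuous; fun_prop⟩
    rw [← h2]
    refine integral_congr_ae (ae_of_all _ fun t => ?_)
    simp only [ContinuousMap.coe_mk, inner_smul_right, real_inner_comm]
  have hI : ∀ᵐ t ∂timeMeasure T, t ∈ Ioo 0 T := by
    rw [timeMeasure, ← restrict_Ioo_eq_restrict_Ioc]
    exact ae_restrict_mem measurableSet_Ioo
  filter_upwards [hI, ae_restrict_of_ae key] with t ht hk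
  have h1 : ∫ s in (0 : ℝ)..t, q s = (∫ s in (0 : ℝ)..t, A (u s)) - ∫ s in (0 : ℝ)..t, F s := by
    have hm : ∀ p : ℝ → V, Integrable p (timeMeasure T) → IntervalIntegrable p volume 0 t :=
      fun p hp => (intervalIntegrable_iff_integrableOn_Ioc_of_le ht.1.le).2
        (IntegrableOn.mono_set hp (Ioc_subset_Ioc_right ht.2.le))
    exact intervalIntegral.integral_sub (hm _ hAi) (hm _ hFi)
  have h2 := hk ht
  rw [hr] at h2
  simp only [h1, hKx] at h2
  have h3 := sub_eq_zero.1 h2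
  rw [← h3]
  abel

/-- Uniqueness for the integrated equation with zero data: testing with `d` itself gives
`∫ ‖j d‖² + ½ ⟪A ∫ d, ∫ d⟫ = 0`. -/
theorem ae_eq_zero_of_integrated {T : ℝ} {j : V →L[ℝ] G} (hj : Function.Injective j)
    {A : V →L[ℝ] V} (hA : ∀ x y, inner ℝ (A x) y = inner ℝ x (A y))
    (hA0 : ∀ x, 0 ≤ inner ℝ (A x) x) {d : ℝ → V} (hd : MemLp d 2 (timeMeasure T))
    (h : ∀ᵐ t ∂timeMeasure T, j.adjoint (j (d t)) + ∫ s in (0 : ℝ)..t, A (d s) = 0) :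
    ∀ᵐ t ∂timeMeasure T, d t = 0 := by
  have hdi : Integrable d (timeMeasure T) := hd.integrable (by norm_num)
  have hAi : Integrable (fun t => A (d t)) (timeMeasure T) := A.integrable_comp hdi
  have hj2 : Integrable (fun t => ‖j (d t)‖ ^ 2) (timeMeasure T) :=
    (j.comp_memLp' hd).integrable_norm_pow'
  have h1 := integral_inner_primitive_add hAi hdi
  have h2 : ∫ t, inner ℝ (∫ s in (0 : ℝ)..t, A (d s)) (d t) ∂timeMeasure T
      = ∫ t, inner ℝ (A (d t)) (∫ s in (0 : ℝ)..t, d s) ∂timeMeasure T := by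
    refine setIntegral_congr_fun measurableSet_Ioc fun t ht => ?_
    have hi : IntervalIntegrable d volume 0 t :=
      (intervalIntegrable_iff_integrableOn_Ioc_of_le ht.1.le).2
        (IntegrableOn.mono_set hdi (Ioc_subset_Ioc_right ht.2))
    rw [A.intervalIntegral_comp_comm hi, hA, real_inner_comm]
  have h3 : ∫ t, inner ℝ (∫ s in (0 : ℝ)..t, A (d s)) (d t) ∂timeMeasure T
      = -∫ t, ‖j (d t)‖ ^ 2 ∂timeMeasure T := by
    rw [← integral_neg]
    refine integral_congr_ae (h.mono fun t ht => ?_)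
    simp only
    rw [eq_neg_of_add_eq_zero_right ht, inner_neg_left, ContinuousLinearMap.adjoint_inner_left,
      real_inner_self_eq_norm_sq]
  rw [← h2, h3, A.integral_comp_comm hdi] at h1
  have h4 : ∫ t, ‖j (d t)‖ ^ 2 ∂timeMeasure T = 0 :=
    le_antisymm (by linarith [hA0 (∫ t, d t ∂timeMeasure T)]) (integral_nonneg fun t => by positivity)
  filter_upwards [(integral_eq_zero_iff_of_nonneg (fun t => by positivity) hj2).1 h4] with t ht
  have h5 : ‖j (d t)‖ ^ 2 = 0 := ht
  refine hj ?_
  rw [map_zero]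
  simpa using h5

end Parabolic

/-! ### Resolvents of `j† j` -/

section Regularity

open Filter Topology

variable {V G : Type*} [NormedAddCommGroup V] [InnerProductSpace ℝ V] [CompleteSpace V]
  [NormedAddCommGroup G] [InnerProductSpace ℝ G] [CompleteSpace G]

/-- The resolvent `(j† j + ε)⁻¹`, from the Lax–Milgram theorem. -/
theorem exists_resolvent (j : V →L[ℝ] G) {ε : ℝ} (hε : 0 < ε) :
    ∃ R : V →L[ℝ] V, (∀ x, j.adjoint (j (R x)) + ε • R x = x) ∧
      ∀ x, R (j.adjoint (j x) + ε • x) = x := by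
  let B : V →L[ℝ] V →L[ℝ] ℝ := (innerSL ℝ : V →L[ℝ] V →L[ℝ] ℝ).comp
    (j.adjoint ∘L j + ε • ContinuousLinearMap.id ℝ V)
  have hB : ∀ x y, B x y = inner ℝ (j.adjoint (j x) + ε • x) y := fun x y => rfl
  have hco : IsCoercive B := by
    refine ⟨ε, hε, fun x => ?_⟩
    rw [hB, inner_add_left, ContinuousLinearMap.adjoint_inner_left, real_inner_smul_left,
      real_inner_self_eq_norm_sq, real_inner_self_eq_norm_sq]
    nlinarith [sq_nonneg ‖j x‖]
  let e := hco.continuousLinearEquivOfBilin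
  have he : ∀ x, e x = j.adjoint (j x) + ε • x := fun x =>
    ext_inner_right ℝ fun y => (hco.continuousLinearEquivOfBilin_apply x y).trans (hB x y)
  refine ⟨e.symm, fun x => ?_, fun x => ?_⟩
  · exact (he _).symm.trans (e.apply_symm_apply x)
  · exact (congrArg e.symm (he x).symm).trans (e.symm_apply_apply x)

/-- For injective `j` the resolvents `R n = (j† j + 1 / (n + 1))⁻¹` are symmetric, commute with
`j† j`, and `R n (j† j)` are contractions converging strongly to the identity. -/
theorem exists_resolvents {j : V →L[ℝ] G} (hj : Function.Injective j) :
    ∃ R : ℕ → V →L[ℝ] V, (∀ n x y, inner ℝ (R n x) y = inner ℝ x (R n y)) ∧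
      (∀ n x, R n (j.adjoint (j x)) = j.adjoint (j (R n x))) ∧
      (∀ n x, ‖R n (j.adjoint (j x))‖ ≤ ‖x‖) ∧
      ∀ x, Tendsto (fun n => R n (j.adjoint (j x))) atTop (𝓝 x) := by
  have hε : ∀ n : ℕ, (0 : ℝ) < 1 / ((n : ℝ) + 1) := fun n => Nat.one_div_pos_of_nat
  choose R hR1 hR2 using fun n => exists_resolvent j (hε n)
  set K : V →L[ℝ] V := j.adjoint ∘L j
  have hKx : ∀ x, j.adjoint (j x) = K x := fun x => rfl
  simp only [hKx] at hR1 hR2 ⊢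
  have hsK : ∀ x y, inner ℝ (K x) y = inner ℝ x (K y) := fun x y => by
    rw [← hKx, ← hKx, ContinuousLinearMap.adjoint_inner_left,
      ContinuousLinearMap.adjoint_inner_right]
  have hsym : ∀ n x y, inner ℝ (R n x) y = inner ℝ x (R n y) := fun n x y => by
    conv_lhs => rw [← hR1 n y]
    conv_rhs => rw [← hR1 n x]
    rw [inner_add_left, inner_add_right, hsK, real_inner_smul_left, real_inner_smul_right]
  have hcomm : ∀ n x, R n (K x) = K (R n x) := fun n x => by
    have h1 : K x = K (K (R n x)) + (1 / ((n : ℝ) + 1)) • K (R n x) := by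
      conv_lhs => rw [← hR1 n x]
      rw [map_add, map_smul]
    rw [h1, hR2]
  have hsq : ∀ n x, ‖K (R n x)‖ ≤ ‖x‖ ∧ (1 / ((n : ℝ) + 1)) * ‖R n x‖ ≤ ‖x‖ := fun n x => by
    have h1 := congrArg (fun z => ‖z‖ ^ 2) (hR1 n x)
    rw [norm_add_sq_real, real_inner_smul_right, norm_smul, Real.norm_of_nonneg (hε n).le] at h1
    have h2 : 0 ≤ inner ℝ (K (R n x)) (R n x) := by
      rw [← hKx, ContinuousLinearMap.adjoint_inner_left]
      exact real_inner_self_nonneg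
    have h3 := mul_nonneg (hε n).le h2
    constructor
    · refine le_of_sq_le_sq ?_ (norm_nonneg _)
      nlinarith [sq_nonneg ((1 / ((n : ℝ) + 1)) * ‖R n x‖)]
    · refine le_of_sq_le_sq ?_ (norm_nonneg _)
      nlinarith [sq_nonneg ‖K (R n x)‖]
  have hcon : ∀ n x, ‖R n (K x)‖ ≤ ‖x‖ := fun n x => by rw [hcomm]; exact (hsq n x).1
  refine ⟨R, hsym, hcomm, hcon, fun x => ?_⟩
  -- convergence on the range of `K`, which is dense since `K` is symmetric and injective
  have hdense : Dense (Set.range K) := by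
    have h1 : (K : V →ₗ[ℝ] V).rangeᗮ = ⊥ := by
      rw [Submodule.eq_bot_iff]
      intro y hy
      have h2 : inner ℝ (K y) y = 0 := hy (K y) ⟨y, rfl⟩
      rw [← hKx, ContinuousLinearMap.adjoint_inner_left, inner_self_eq_zero] at h2
      exact hj (h2.trans (map_zero j).symm)
    have h3 := Submodule.dense_iff_topologicalClosure_eq_top.2
      ((Submodule.topologicalClosure_eq_top_iff).2 h1)
    exact h3
  have hrange : ∀ y n, ‖R n (K (K y)) - K y‖ ≤ (1 / ((n : ℝ) + 1)) * ‖y‖ := fun y n => by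
    have h1 : R n (K (K y)) - K y = -((1 / ((n : ℝ) + 1)) • R n (K y)) := by
      have h2 := hR1 n (K y)
      rw [hcomm]
      nth_rewrite 2 [← h2]
      abel
    rw [h1, norm_neg, norm_smul, Real.norm_of_nonneg (hε n).le]
    exact mul_le_mul_of_nonneg_left (hcon n y) (hε n).le
  rw [Metric.tendsto_atTop]
  intro δ hδ
  obtain ⟨_, ⟨y, rfl⟩, hy⟩ := hdense.exists_dist_lt x (half_pos (half_pos hδ))
  have h1 : Tendsto (fun n : ℕ => (1 / ((n : ℝ) + 1)) * ‖y‖) atTop (𝓝 0) := by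
    simpa using (tendsto_one_div_add_atTop_nhds_zero_nat (𝕜 := ℝ)).mul_const ‖y‖
  obtain ⟨N, hN⟩ := Metric.tendsto_atTop.1 h1 (δ / 2) (half_pos hδ)
  refine ⟨N, fun n hn => ?_⟩
  have h2 := hN n hn
  rw [Real.dist_0_eq_abs, abs_of_nonneg (mul_nonneg (hε n).le (norm_nonneg _))] at h2
  have h3 := hcon n (x - K y)
  rw [dist_eq_norm] at hy ⊢
  have h4 : R n (K x) - x = R n (K (x - K y)) + (R n (K (K y)) - K y) - (x - K y) := by
    simp only [map_sub]; abel
  calc ‖R n (K x) - x‖ ≤ ‖R n (K (x - K y))‖ + ‖R n (K (K y)) - K y‖ + ‖x - K y‖ := by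
        rw [h4]
        exact (norm_sub_le _ _).trans (add_le_add_left (norm_add_le _ _) _)
    _ < δ := by linarith [hrange y n]

end Regularity

/-! ### Continuous representatives -/

section ContinuousRepresentative

theorem integrable_norm_mul_norm {E : Type*} [NormedAddCommGroup E] {T : ℝ} {v g : ℝ → E}
    (hv : MemLp v 2 (timeMeasure T)) (hg : MemLp g 2 (timeMeasure T)) :
    Integrable (fun t => ‖v t‖ * ‖g t‖) (timeMeasure T) :=
  hv.norm.integrable_mul hg.norm

open Filter Topology

variable {V H G : Type*} [NormedAddCommGroup V] [InnerProductSpace ℝ V] [CompleteSpace V]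
  [NormedAddCommGroup H] [InnerProductSpace ℝ H] [CompleteSpace H]
  [NormedAddCommGroup G] [InnerProductSpace ℝ G] [CompleteSpace G]

/-- If `j† j v` is a primitive `k` of `g`, then `‖j S k‖²` varies by at most
`2 ∫ ‖S j† j S j† j v‖ ‖g‖`, for every symmetric operator `S`. -/
theorem abs_norm_sq_sub_le {T : ℝ} (j : V →L[ℝ] G) {v g : ℝ → V}
    (hv : MemLp v 2 (timeMeasure T)) (hg : MemLp g 2 (timeMeasure T)) (c₀ : V)
    (hk : ∀ᵐ t ∂timeMeasure T, j.adjoint (j (v t)) = c₀ + ∫ s in (0 : ℝ)..t, g s)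
    (S : V →L[ℝ] V) (hS : ∀ x y, inner ℝ (S x) y = inner ℝ x (S y)) {t : ℝ}
    (ht : t ∈ Icc 0 T) :
    |‖j (S (c₀ + ∫ s in (0 : ℝ)..t, g s))‖ ^ 2 - ‖j (S c₀)‖ ^ 2|
      ≤ 2 * ∫ s, ‖S (j.adjoint (j (S (j.adjoint (j (v s))))))‖ * ‖g s‖ ∂timeMeasure T := by
  have hsub : timeMeasure t ≤ timeMeasure T :=
    Measure.restrict_mono_set _ (Ioc_subset_Ioc_right ht.2)
  have hgi : Integrable g (timeMeasure t) := (hg.integrable (by norm_num)).mono_measure hsub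
  have hint : ∀ s ∈ Icc 0 t, IntervalIntegrable g volume 0 s := fun s hs =>
    (intervalIntegrable_iff_integrableOn_Ioc_of_le hs.1).2
      (IntegrableOn.mono_set hgi (Ioc_subset_Ioc_right hs.2))
  let q : V →L[ℝ] G := j ∘L S
  have hq : ∀ x, q x = j (S x) := fun x => rfl
  have hqk : ∀ s ∈ Icc 0 t, j (S (c₀ + ∫ r in (0 : ℝ)..s, g r))
      = j (S c₀) + ∫ r in (0 : ℝ)..s, q (g r) := fun s hs => by
    rw [q.intervalIntegral_comp_comm (hint s hs), ← hq, ← hq, map_add]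
  have hdom : Integrable (fun s => ‖S (j.adjoint (j (S (j.adjoint (j (v s))))))‖ * ‖g s‖)
      (timeMeasure T) :=
    integrable_norm_mul_norm
      ((S ∘L j.adjoint ∘L j ∘L S ∘L j.adjoint ∘L j).comp_memLp' hv) hg
  rw [hqk t ⟨ht.1, le_rfl⟩, norm_sq_add_primitive ht.1 _ (q.integrable_comp hgi),
    add_sub_cancel_left, abs_mul, abs_two]
  refine mul_le_mul_of_nonneg_left ?_ zero_le_two
  calc |∫ s, inner ℝ (j (S c₀) + ∫ r in (0 : ℝ)..s, q (g r)) (q (g s)) ∂timeMeasure t|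
      ≤ ∫ s, ‖S (j.adjoint (j (S (j.adjoint (j (v s))))))‖ * ‖g s‖ ∂timeMeasure t := by
        rw [← Real.norm_eq_abs]
        refine norm_integral_le_of_norm_le (hdom.mono_measure hsub) ?_
        filter_upwards [ae_mono hsub hk, ae_restrict_mem measurableSet_Ioc] with s hs hst
        rw [← hqk s ⟨hst.1.le, hst.2⟩, ← hs, hq, ← ContinuousLinearMap.adjoint_inner_left, ← hS]
        exact norm_inner_le_norm (𝕜 := ℝ) _ _
    _ ≤ _ := integral_mono_measure hsub (ae_of_all _ fun s => by positivity) hdom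

/-- The embedding of the energy space into `C([0, T]; H)`: if `v` is square integrable with values
in `V` and `(j† j) v`, with `j = D ∘ ι`, has a square integrable derivative, then `ι v` has a
continuous representative `w`. It is the uniform limit of `ι (j† j + ε)⁻¹ k` as `ε → 0`, where `k`
is the continuous representative of `j† j v`. -/
theorem exists_continuous_representative {T : ℝ} (hT : 0 < T) (ι : V →L[ℝ] H)
    (hι : Function.Injective ι) (D : H →L[ℝ] G) {C : ℝ} (hD : ∀ x, ‖x‖ ≤ C * ‖D x‖)
    {v g : ℝ → V} (hv : MemLp v 2 (timeMeasure T)) (hg : MemLp g 2 (timeMeasure T)) (c₀ : V)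
    (hk : ∀ᵐ t ∂timeMeasure T,
      (D ∘L ι).adjoint (D (ι (v t))) = c₀ + ∫ s in (0 : ℝ)..t, g s) :
    ∃ w : C(Icc (0 : ℝ) T, H),
      (∀ᵐ t ∂timeMeasure T, ∀ ht : t ∈ Icc (0 : ℝ) T, w ⟨t, ht⟩ = ι (v t)) ∧
      (∀ t, (D ∘L ι).adjoint (D (w t)) = c₀ + ∫ s in (0 : ℝ)..(t : ℝ), g s) ∧
      ∀ t, ‖D (w t)‖ ^ 2 ≤ ‖D (w ⟨0, ⟨le_rfl, hT.le⟩⟩)‖ ^ 2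
        + 2 * ∫ s, ‖v s‖ * ‖g s‖ ∂timeMeasure T := by
  set j : V →L[ℝ] G := D ∘L ι with hj
  have hjx : ∀ x, D (ι x) = j x := fun x => rfl
  simp only [hjx] at hk
  have hjinj : Function.Injective j := by
    refine (injective_iff_map_eq_zero j).2 fun x hx => hι ?_
    have h1 := hD (ι x)
    rw [hjx, hx, norm_zero, mul_zero] at h1
    rw [norm_le_zero_iff.1 h1, map_zero]
  obtain ⟨R, hRs, hRc, hRn, hRt⟩ := exists_resolvents hjinj
  set k : ℝ → V := fun t => c₀ + ∫ s in (0 : ℝ)..t, g s with hkdef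
  have hgi : Integrable g (timeMeasure T) := hg.integrable (by norm_num)
  have hkc : ContinuousOn k (Icc 0 T) := continuousOn_const.add (continuousOn_primitive hgi)
  have hkc' : Continuous fun t : Icc (0 : ℝ) T => k t := hkc.domRestrict
  have hvg := integrable_norm_mul_norm hv hg
  let P : ℕ → V →L[ℝ] V := fun n => R n ∘L j.adjoint ∘L j
  have hP : ∀ n x, P n x = R n (j.adjoint (j x)) := fun n x => rfl
  -- the errors of the resolvents on `v`
  set e : ℕ → ℝ := fun n => ∫ s, ‖P n (v s) - v s‖ * ‖g s‖ ∂timeMeasure T with he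
  have hPv : ∀ n, MemLp (fun s => P n (v s) - v s) 2 (timeMeasure T) := fun n =>
    ((P n).comp_memLp' hv).sub hv
  have he0 : Tendsto e atTop (𝓝 0) := by
    have h1 := tendsto_integral_of_dominated_convergence (μ := timeMeasure T)
      (F := fun n s => ‖P n (v s) - v s‖ * ‖g s‖) (f := fun _ => (0 : ℝ))
      (fun s => 2 * (‖v s‖ * ‖g s‖))
      (fun n => (integrable_norm_mul_norm (hPv n) hg).aestronglyMeasurable) (hvg.const_mul 2)
      (fun n => ae_of_all _ fun s => ?_) (ae_of_all _ fun s => ?_)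
    · simpa using h1
    · rw [Real.norm_of_nonneg (by positivity), ← mul_assoc]
      refine mul_le_mul_of_nonneg_right ?_ (norm_nonneg _)
      rw [hP]
      linarith [norm_sub_le (R n (j.adjoint (j (v s)))) (v s), hRn n (v s)]
    · have h2 : Tendsto (fun n => ‖P n (v s) - v s‖) atTop (𝓝 0) := by
        have := (hRt (v s)).sub_const (v s)
        rw [sub_self] at this
        rw [← norm_zero (E := V)]
        exact this.norm
      simpa using h2.mul_const ‖g s‖
  -- a time at which `k` is in the range of `j† j`, where the energy is compared
  obtain ⟨s₀, hs₀k, hs₀⟩ : ∃ s, j.adjoint (j (v s)) = k s ∧ s ∈ Ioc 0 T := by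
    have : NeZero (timeMeasure T) := ⟨by
      rw [Ne, Measure.restrict_eq_zero, Real.volume_Ioc]
      simpa using hT⟩
    exact (hk.and (ae_restrict_mem measurableSet_Ioc)).exists
  set p : ℕ → ℝ := fun n => ‖j (P n (v s₀) - v s₀)‖ ^ 2 with hp
  have hp0 : Tendsto p atTop (𝓝 0) := by
    have h1 := (hRt (v s₀)).sub_const (v s₀)
    rw [sub_self] at h1
    have h2 := ((j.continuous.tendsto 0).comp h1).norm.pow 2
    rw [map_zero, norm_zero, zero_pow two_ne_zero] at h2
    exact h2
  have hdiff : ∀ n m t, t ∈ Icc 0 T →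
      ‖j (R n (k t)) - j (R m (k t))‖ ^ 2 ≤ (2 * p n + 8 * e n) + (2 * p m + 8 * e m) := by
    intro n m t ht
    -- `‖j S k‖²` at time `t` differs little from its value at `s₀`
    set S : V →L[ℝ] V := R n - R m
    have hS : ∀ x, S x = R n x - R m x := fun x => rfl
    have hSs : ∀ x y, inner ℝ (S x) y = inner ℝ x (S y) := fun x y => by
      rw [hS, hS, inner_sub_left, inner_sub_right, hRs, hRs]
    have hSK : ∀ x, S (j.adjoint (j x)) = (P n x - x) - (P m x - x) := fun x => by
      rw [hS, hP, hP]; abel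
    have h1 := abs_norm_sq_sub_le j hv hg c₀ hk S hSs ht
    have h2 := abs_norm_sq_sub_le j hv hg c₀ hk S hSs ⟨hs₀.1.le, hs₀.2⟩
    have h3 : ∫ s, ‖S (j.adjoint (j (S (j.adjoint (j (v s))))))‖ * ‖g s‖ ∂timeMeasure T
        ≤ 2 * (e n + e m) := by
      rw [he]
      simp only
      rw [← integral_add (integrable_norm_mul_norm (hPv n) hg)
        (integrable_norm_mul_norm (hPv m) hg), ← integral_const_mul]
      refine integral_mono (integrable_norm_mul_norm
        ((S ∘L j.adjoint ∘L j ∘L S ∘L j.adjoint ∘L j).comp_memLp' hv) hg)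
        (((integrable_norm_mul_norm (hPv n) hg).add
          (integrable_norm_mul_norm (hPv m) hg)).const_mul 2) fun s => ?_
      set y := S (j.adjoint (j (v s))) with hy
      have h4 : ‖S (j.adjoint (j y))‖ ≤ 2 * ‖y‖ := by
        rw [hS]
        linarith [norm_sub_le (R n (j.adjoint (j y))) (R m (j.adjoint (j y))), hRn n y, hRn m y]
      have h5 : ‖y‖ ≤ ‖P n (v s) - v s‖ + ‖P m (v s) - v s‖ := by
        rw [hy, hSK]
        exact norm_sub_le _ _
      have h6 : 0 ≤ ‖g s‖ := norm_nonneg _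
      have h7 : ‖S (j.adjoint (j y))‖ * ‖g s‖
          ≤ 2 * (‖P n (v s) - v s‖ + ‖P m (v s) - v s‖) * ‖g s‖ :=
        mul_le_mul_of_nonneg_right (by linarith) h6
      simp only
      linarith
    have h4 : ‖j (S (k s₀))‖ ^ 2 ≤ 2 * p n + 2 * p m := by
      rw [← hs₀k, hSK, map_sub]
      have h5 := norm_sub_le (j (P n (v s₀) - v s₀)) (j (P m (v s₀) - v s₀))
      have h6 := pow_le_pow_left₀ (norm_nonneg _) h5 2
      have h7 := add_sq_le (a := ‖j (P n (v s₀) - v s₀)‖) (b := ‖j (P m (v s₀) - v s₀)‖)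
      simp only [hp]
      linarith
    rw [← map_sub, ← hS]
    have h5 := abs_le.1 h1
    have h6 := abs_le.1 h2
    change _ ≤ _ ∧ ‖j (S (k t))‖ ^ 2 - _ ≤ _ at h5
    change _ ≤ ‖j (S (k s₀))‖ ^ 2 - _ ∧ _ at h6
    linarith [h5.2, h6.1]
  have hDι : ∀ x, ‖ι x‖ ≤ C * ‖j x‖ := fun x => hD (ι x)
  let W : ℕ → C(Icc (0 : ℝ) T, H) := fun n =>
    ⟨fun t => ι (R n (k t)), ι.continuous.comp ((R n).continuous.comp hkc')⟩
  have hW : ∀ n t, W n t = ι (R n (k t)) := fun n t => rfl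
  set a : ℕ → ℝ := fun n => 2 * p n + 8 * e n with ha
  have ha0 : Tendsto a atTop (𝓝 0) := by
    simpa using (hp0.const_mul 2).add (he0.const_mul 8)
  have hann : ∀ n, 0 ≤ a n := fun n => by
    have : 0 ≤ e n := integral_nonneg fun s => by positivity
    have : 0 ≤ p n := sq_nonneg _
    simp only [ha]; positivity
  have hcau : CauchySeq W := by
    rw [Metric.cauchySeq_iff]
    intro δ hδ
    set C' := |C| + 1 with hC'
    have hC'0 : 0 < C' := by positivity
    have hδ' : 0 < (δ / (2 * C')) ^ 2 / 2 := by positivity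
    obtain ⟨N, hN⟩ := Metric.tendsto_atTop.1 ha0 _ hδ'
    refine ⟨N, fun m hm n hn => ?_⟩
    have h1 : ∀ i ≥ N, a i < (δ / (2 * C')) ^ 2 / 2 := fun i hi => by
      have := hN i hi
      rwa [Real.dist_0_eq_abs, abs_of_nonneg (hann i)] at this
    refine lt_of_le_of_lt ((ContinuousMap.dist_le (C := δ / 2) (by positivity)).2 fun t => ?_)
      (half_lt_self hδ)
    rw [dist_eq_norm, hW, hW, ← map_sub]
    have h2 : ‖j (R m (k t) - R n (k t))‖ ≤ δ / (2 * C') := by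
      refine le_of_sq_le_sq ?_ (by positivity)
      rw [map_sub]
      have := hdiff m n t t.2
      have h3 := h1 m hm
      have h4 := h1 n hn
      simp only [ha] at h3 h4
      linarith
    calc ‖ι (R m (k t) - R n (k t))‖ ≤ C * ‖j (R m (k t) - R n (k t))‖ := hDι _
      _ ≤ C' * (δ / (2 * C')) := by
        refine mul_le_mul ?_ h2 (norm_nonneg _) hC'0.le
        linarith [le_abs_self C]
      _ = δ / 2 := by field_simp
  obtain ⟨w, hw⟩ := cauchySeq_tendsto_of_complete hcau
  have hwt : ∀ t : Icc (0 : ℝ) T, Tendsto (fun n => ι (R n (k t))) atTop (𝓝 (w t)) := fun t =>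
    ((continuous_eval_const t).tendsto w).comp hw
  have hDwt : ∀ t : Icc (0 : ℝ) T, Tendsto (fun n => j (R n (k t))) atTop (𝓝 (D (w t))) :=
    fun t => (D.continuous.tendsto _).comp (hwt t)
  refine ⟨w, ?_, fun t => ?_, fun t => ?_⟩
  · filter_upwards [hk] with t ht htI
    refine tendsto_nhds_unique (hwt ⟨t, htI⟩) ?_
    have h1 := (ι.continuous.tendsto _).comp (hRt (v t))
    rw [ht] at h1
    exact h1
  · refine tendsto_nhds_unique ((j.adjoint.continuous.tendsto _).comp (hDwt t)) ?_
    exact (hRt (k t)).congr fun n => hRc n (k t)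
  · have h1 : ∀ n, ‖j (R n (k t))‖ ^ 2
        ≤ ‖j (R n (k 0))‖ ^ 2 + 2 * ∫ s, ‖v s‖ * ‖g s‖ ∂timeMeasure T := by
      intro n
      have h2 := abs_norm_sq_sub_le j hv hg c₀ hk (R n) (hRs n) t.2
      have h3 : ∫ s, ‖R n (j.adjoint (j (R n (j.adjoint (j (v s))))))‖ * ‖g s‖ ∂timeMeasure T
          ≤ ∫ s, ‖v s‖ * ‖g s‖ ∂timeMeasure T := by
        refine integral_mono (integrable_norm_mul_norm
          ((R n ∘L j.adjoint ∘L j ∘L R n ∘L j.adjoint ∘L j).comp_memLp' hv) hg) hvg fun s => ?_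
        exact mul_le_mul_of_nonneg_right ((hRn n _).trans (hRn n _)) (norm_nonneg _)
      have h4 := (abs_le.1 h2).2
      have h5 : k 0 = c₀ := by simp [hkdef]
      rw [h5]
      change ‖j (R n (k t))‖ ^ 2 - _ ≤ _ at h4
      linarith
    exact le_of_tendsto_of_tendsto' ((hDwt t).norm.pow 2)
      (((hDwt ⟨0, ⟨le_rfl, hT.le⟩⟩).norm.pow 2).add_const _) h1

end ContinuousRepresentative

/-! ### Calculus of test functions -/

section TestFunctions

variable {Ω : Set Plane} {φ ψ : Plane → ℝ}

theorem contDiff_partialDeriv (hφ : ContDiff ℝ ∞ φ) (i : Fin 2) :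
    ContDiff ℝ ∞ (partialDeriv i φ) :=
  (hφ.fderiv_right (by simp)).clm_apply contDiff_const

theorem contDiff_iterate_partialDeriv (hφ : ContDiff ℝ ∞ φ) (i : Fin 2) (n : ℕ) :
    ContDiff ℝ ∞ ((partialDeriv i)^[n] φ) := by
  induction n with
  | zero => exact hφ
  | succ n ih => rw [Function.iterate_succ_apply']; exact contDiff_partialDeriv ih i

theorem partialDeriv_comm (hφ : ContDiff ℝ ∞ φ) (i l : Fin 2) :
    partialDeriv i (partialDeriv l φ) = partialDeriv l (partialDeriv i φ) := by
  have h1 : ∀ (a b : Fin 2) (x : Plane), partialDeriv a (partialDeriv b φ) x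
      = fderiv ℝ (fderiv ℝ φ) x (EuclideanSpace.single a 1) (EuclideanSpace.single b 1) := by
    intro a b x
    have h2 : DifferentiableAt ℝ (fderiv ℝ φ) x :=
      ((hφ.fderiv_right (m := ∞) (by simp)).differentiable (by simp)) x
    unfold partialDeriv
    rw [fderiv_clm_apply h2 (differentiableAt_const _)]
    simp
  funext x
  rw [h1, h1]
  exact (hφ.contDiffAt.isSymmSndFDerivAt (by
    rw [minSmoothness_of_isRCLikeNormedField]; exact ENat.LEInfty.out)) _ _

theorem partialDeriv_iterate_comm (hφ : ContDiff ℝ ∞ φ) (i l : Fin 2) (n : ℕ) :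
    partialDeriv i ((partialDeriv l)^[n] φ) = (partialDeriv l)^[n] (partialDeriv i φ) := by
  induction n with
  | zero => rfl
  | succ n ih =>
    rw [Function.iterate_succ_apply', partialDeriv_comm (contDiff_iterate_partialDeriv hφ l n), ih,
      Function.iterate_succ_apply']

theorem iterate_partialDeriv_comm (hφ : ContDiff ℝ ∞ φ) (i l : Fin 2) (m n : ℕ) :
    (partialDeriv i)^[m] ((partialDeriv l)^[n] φ)
      = (partialDeriv l)^[n] ((partialDeriv i)^[m] φ) := by
  induction m with
  | zero => rfl
  | succ m ih =>
    rw [Function.iterate_succ_apply', ih, Function.iterate_succ_apply',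
      partialDeriv_iterate_comm (contDiff_iterate_partialDeriv hφ i m)]

theorem IsTestFunction.iterate_partialDeriv (hψ : IsTestFunction Ω ψ) (i : Fin 2) (n : ℕ) :
    IsTestFunction Ω ((Biharm.partialDeriv i)^[n] ψ) := by
  induction n with
  | zero => exact hψ
  | succ n ih => rw [Function.iterate_succ_apply']; exact ih.partialDeriv i

theorem setIntegral_mul_test (f : Plane → ℝ) (hψ : IsTestFunction Ω ψ) :
    ∫ x in Ω, f x * ψ x = ∫ x, f x * ψ x := by
  refine setIntegral_eq_integral_of_forall_compl_eq_zero fun x hx => ?_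
  rw [image_eq_zero_of_notMem_tsupport fun h => hx (hψ.tsupport_subset h), mul_zero]

/-- Integration by parts against a test function. -/
theorem integral_mul_partialDeriv (hφ : ContDiff ℝ ∞ φ) (hψ : IsTestFunction Ω ψ) (i : Fin 2) :
    ∫ x in Ω, φ x * partialDeriv i ψ x = -∫ x in Ω, partialDeriv i φ x * ψ x := by
  rw [setIntegral_mul_test _ hψ, setIntegral_mul_test _ (hψ.partialDeriv i)]
  have hc : ∀ {f χ : Plane → ℝ}, ContDiff ℝ ∞ f → IsTestFunction Ω χ →
      Integrable fun x => f x * χ x := fun hf hχ =>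
    (hf.continuous.mul hχ.contDiff.continuous).integrable_of_hasCompactSupport
      hχ.hasCompactSupport.mul_left
  exact integral_mul_fderiv_eq_neg_fderiv_mul_of_integrable
    (hc (contDiff_partialDeriv hφ i) hψ) (hc hφ (hψ.partialDeriv i)) (hc hφ hψ)
    (fun x _ => hφ.differentiable (by simp) x)
    (fun x _ => hψ.contDiff.differentiable (by simp) x)

theorem integral_mul_iterate_partialDeriv (hφ : ContDiff ℝ ∞ φ) (hψ : IsTestFunction Ω ψ)
    (i : Fin 2) (n : ℕ) :
    ∫ x in Ω, φ x * (partialDeriv i)^[n] ψ x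
      = (-1) ^ n * ∫ x in Ω, (partialDeriv i)^[n] φ x * ψ x := by
  induction n generalizing φ with
  | zero => simp
  | succ n ih =>
    rw [Function.iterate_succ_apply', integral_mul_partialDeriv hφ (hψ.iterate_partialDeriv i n),
      ih (contDiff_partialDeriv hφ i), Function.iterate_succ_apply, pow_succ]
    ring

theorem integral_mul_multiDeriv {k : ℕ} (hφ : ContDiff ℝ ∞ φ) (hψ : IsTestFunction Ω ψ)
    (α : MultiIndex k) :
    ∫ x in Ω, φ x * multiDeriv α ψ x = (-1) ^ α.length * ∫ x in Ω, multiDeriv α φ x * ψ x := by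
  unfold multiDeriv MultiIndex.length
  rw [integral_mul_iterate_partialDeriv hφ (hψ.iterate_partialDeriv 1 _),
    integral_mul_iterate_partialDeriv (contDiff_iterate_partialDeriv hφ 0 _) hψ,
    iterate_partialDeriv_comm hφ, pow_add, mul_assoc]

/-- A test function as an element of `L²(Ω)`. -/
def IsTestFunction.toL2 (hφ : IsTestFunction Ω φ) : L2 Ω := hφ.memLp.toLp φ

theorem IsTestFunction.coeFn_toL2 (hφ : IsTestFunction Ω φ) : hφ.toL2 =ᵐ[vol Ω] φ :=
  hφ.memLp.coeFn_toLp

theorem inner_toL2 (u : L2 Ω) (hφ : IsTestFunction Ω φ) :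
    inner ℝ u hφ.toL2 = ∫ x in Ω, u x * φ x := by
  rw [L2.inner_def]
  refine integral_congr_ae ?_
  filter_upwards [hφ.coeFn_toL2] with x hx
  rw [hx]
  simp [mul_comm]

theorem inner_toL2_toL2 (hφ : IsTestFunction Ω φ) (hψ : IsTestFunction Ω ψ) :
    inner ℝ hφ.toL2 hψ.toL2 = ∫ x in Ω, φ x * ψ x := by
  rw [inner_toL2]
  refine integral_congr_ae ?_
  filter_upwards [hφ.coeFn_toL2] with x hx
  rw [hx]

/-- An element of `L²(Ω)` orthogonal to all test functions vanishes. -/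
theorem eq_zero_of_forall_inner_toL2 (hΩ : IsOpen Ω) (hΩb : Bornology.IsBounded Ω) {u : L2 Ω}
    (h : ∀ φ : Plane → ℝ, ∀ hφ : IsTestFunction Ω φ, inner ℝ u hφ.toL2 = 0) : u = 0 := by
  have : IsFiniteMeasure (vol Ω) := ⟨by
    rw [Measure.restrict_apply_univ]
    exact hΩb.measure_lt_top⟩
  have h1 : IntegrableOn u Ω := (Lp.memLp u).integrable (by norm_num)
  have h2 : ∀ᵐ x, x ∈ Ω → u x = 0 := by
    refine hΩ.ae_eq_zero_of_integral_contDiff_smul_eq_zero h1.locallyIntegrableOn ?_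
    intro φ hφs hφc hφt
    have hφ : IsTestFunction Ω φ := ⟨hφs, hφc, hφt⟩
    have h3 := h φ hφ
    rw [inner_toL2, setIntegral_mul_test _ hφ] at h3
    simpa [mul_comm] using h3
  refine Lp.ext ?_
  filter_upwards [(ae_restrict_iff' hΩ.measurableSet).2 h2, Lp.coeFn_zero ℝ 2 (vol Ω)] with x h3 h4
  rw [h3, h4, Pi.zero_apply]

/-- The Poincaré inequality in a bounded domain. It follows from
`∫ φ² = -2 ∫ x₀ φ ∂₀φ`, by integration by parts. -/
theorem norm_toL2_le_partialDeriv {R : ℝ} (hR : ∀ x ∈ Ω, ‖x‖ ≤ R) (hΩ : IsOpen Ω)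
    (hφ : IsTestFunction Ω φ) :
    ‖hφ.toL2‖ ≤ 2 * R * ‖(hφ.partialDeriv 0).toL2‖ := by
  let X : Plane → ℝ := fun x => x 0
  have hX : ContDiff ℝ ∞ X := (EuclideanSpace.proj (𝕜 := ℝ) (0 : Fin 2)).contDiff
  have hXd : ∀ x, partialDeriv 0 X x = 1 := fun x => by
    have : X = (EuclideanSpace.proj (𝕜 := ℝ) (0 : Fin 2) : Plane → ℝ) := rfl
    unfold partialDeriv
    rw [this, ContinuousLinearMap.fderiv]
    simp
  have hXφ : IsTestFunction Ω fun x => X x * φ x :=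
    ⟨hX.mul hφ.contDiff, hφ.hasCompactSupport.mul_left,
      (tsupport_mul_subset_right).trans hφ.tsupport_subset⟩
  have hd : ∀ x, partialDeriv 0 (fun x => X x * φ x) x = φ x + X x * partialDeriv 0 φ x := by
    intro x
    have h1 := hXd x
    unfold partialDeriv at h1 ⊢
    rw [fderiv_fun_mul (hX.differentiable (by simp) x) (hφ.contDiff.differentiable (by simp) x)]
    simp [h1]
    ring
  have h1 := integral_mul_partialDeriv hXφ.contDiff hφ 0
  have hi1 : Integrable (fun x => φ x * φ x) (vol Ω) := hφ.memLp.integrable_mul hφ.memLp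
  have hi2 : Integrable (fun x => X x * φ x * partialDeriv 0 φ x) (vol Ω) :=
    hXφ.memLp.integrable_mul (hφ.partialDeriv 0).memLp
  have h2 : ∫ x in Ω, partialDeriv 0 (fun x => X x * φ x) x * φ x
      = (∫ x in Ω, φ x * φ x) + ∫ x in Ω, X x * φ x * partialDeriv 0 φ x := by
    rw [← integral_add hi1 hi2]
    refine integral_congr_ae (ae_of_all _ fun x => ?_)
    simp only [hd]
    ring
  have h3 : ‖hφ.toL2‖ ^ 2 = -2 * inner ℝ hXφ.toL2 (hφ.partialDeriv 0).toL2 := by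
    rw [← real_inner_self_eq_norm_sq, inner_toL2_toL2, inner_toL2_toL2]
    linarith
  have h4 : ‖hXφ.toL2‖ ≤ R * ‖hφ.toL2‖ := by
    refine Lp.norm_le_mul_norm_of_ae_le_mul ?_
    filter_upwards [hXφ.coeFn_toL2, hφ.coeFn_toL2, ae_restrict_mem hΩ.measurableSet]
      with x h5 h6 hx
    rw [h5, h6, norm_mul]
    refine mul_le_mul_of_nonneg_right ?_ (norm_nonneg _)
    exact (PiLp.norm_apply_le x 0).trans (hR x hx)
  have h5 := abs_real_inner_le_norm hXφ.toL2 (hφ.partialDeriv 0).toL2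
  have h6 : ‖hφ.toL2‖ ^ 2 ≤ 2 * R * ‖hφ.toL2‖ * ‖(hφ.partialDeriv 0).toL2‖ := by
    have h7 := mul_le_mul_of_nonneg_right h4 (norm_nonneg (hφ.partialDeriv 0).toL2)
    have h8 := neg_abs_le (inner ℝ hXφ.toL2 (hφ.partialDeriv 0).toL2)
    linarith
  rcases (norm_nonneg hφ.toL2).eq_or_lt with h0 | h0
  · rw [← h0]
    rcases Ω.eq_empty_or_nonempty with rfl | ⟨x, hx⟩
    · have : ‖(hφ.partialDeriv 0).toL2‖ = 0 := by
        rw [norm_eq_zero]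
        exact Lp.ext (by simp [Filter.EventuallyEq])
      rw [this, mul_zero]
    · have := (norm_nonneg x).trans (hR x hx)
      positivity
  · refine le_of_mul_le_mul_left ?_ h0
    linarith

theorem toL2_congr (hφ : IsTestFunction Ω φ) (hψ : IsTestFunction Ω ψ) (h : φ = ψ) :
    hφ.toL2 = hψ.toL2 := by
  subst h; rfl

/-- `(∂₀² φ, ∂₁² φ) = ‖∂₀ ∂₁ φ‖²`. -/
theorem inner_pure_second (hφ : IsTestFunction Ω φ) :
    inner ℝ ((hφ.partialDeriv 0).partialDeriv 0).toL2 ((hφ.partialDeriv 1).partialDeriv 1).toL2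
      = ‖((hφ.partialDeriv 1).partialDeriv 0).toL2‖ ^ 2 := by
  rw [← real_inner_self_eq_norm_sq, inner_toL2_toL2, inner_toL2_toL2,
    integral_mul_partialDeriv ((hφ.partialDeriv 0).partialDeriv 0).contDiff (hφ.partialDeriv 1),
    partialDeriv_comm (hφ.partialDeriv 0).contDiff 1 0, partialDeriv_comm hφ.contDiff 1 0,
    integral_mul_partialDeriv ((hφ.partialDeriv 1).partialDeriv 0).contDiff (hφ.partialDeriv 1)]

end TestFunctions

/-! ### The spaces `H^k_0(Ω)` -/

section SobolevSpaces

variable {Ω : Set Plane} {φ ψ : Plane → ℝ} {k : ℕ}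

theorem isClosed_sobolev (k : ℕ) (Ω : Set Plane) :
    IsClosed (sobolev k Ω : Set (PiLp 2 fun _ : MultiIndex k => L2 Ω)) := by
  have h : (sobolev k Ω : Set (PiLp 2 fun _ : MultiIndex k => L2 Ω))
      = ⋂ (α : MultiIndex k) (φ : Plane → ℝ) (hφ : IsTestFunction Ω φ),
        {U | inner ℝ (U (zeroIdx k)) (hφ.multiDeriv α).toL2
          = (-1) ^ α.length * inner ℝ (U α) hφ.toL2} := by
    ext U
    simp only [mem_iInter, mem_ofPred_eq, inner_toL2]
    rfl
  rw [h]
  refine isClosed_iInter fun α => isClosed_iInter fun φ => isClosed_iInter fun hφ => ?_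
  have hc : ∀ β : MultiIndex k, Continuous fun U : PiLp 2 fun _ : MultiIndex k => L2 Ω => U β :=
    fun β => PiLp.continuous_apply 2 _ β
  exact isClosed_eq ((hc _).inner continuous_const)
    (continuous_const.mul ((hc α).inner continuous_const))

/-- Weak derivatives are preserved under `L²` limits, so that the Sobolev spaces are Hilbert
spaces. -/
instance (k : ℕ) (Ω : Set Plane) : CompleteSpace (HZero k Ω) := by
  have h1 : CompleteSpace (sobolev k Ω) := (isClosed_sobolev k Ω).completeSpace_coe
  have h2 : IsClosed (sobolevZero k Ω : Set (sobolev k Ω)) :=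
    Submodule.isClosed_topologicalClosure _
  exact h2.completeSpace_coe

theorem HZero.isWeakDeriv (v : HZero k Ω) (α : MultiIndex k) :
    IsWeakDeriv Ω α (toL2 Ω v) (weakDeriv Ω α v) :=
  (inclusion k Ω v).2 α

theorem HZero.inner_weakDeriv (v : HZero k Ω) (α : MultiIndex k) (hφ : IsTestFunction Ω φ) :
    inner ℝ (weakDeriv Ω α v) hφ.toL2
      = (-1) ^ α.length * inner ℝ (toL2 Ω v) (hφ.multiDeriv α).toL2 := by
  rw [inner_toL2, inner_toL2, v.isWeakDeriv α φ hφ, ← mul_assoc, ← mul_pow]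
  simp

theorem HZero.norm_sq_eq (v : HZero k Ω) : ‖v‖ ^ 2 = ∑ α, ‖weakDeriv Ω α v‖ ^ 2 :=
  PiLp.norm_sq_eq_of_L2 _ (inclusion k Ω v).1

/-- An element of `H^k_0(Ω)` is determined by its function. -/
theorem toL2_injective (hΩ : IsOpen Ω) (hΩb : Bornology.IsBounded Ω) :
    Function.Injective (toL2 (k := k) Ω) := by
  refine (injective_iff_map_eq_zero _).2 fun v hv => ?_
  have h1 : ∀ α, weakDeriv Ω α v = 0 := fun α =>
    eq_zero_of_forall_inner_toL2 hΩ hΩb fun φ hφ => by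
      rw [HZero.inner_weakDeriv, hv, inner_zero_left, mul_zero]
  have h2 := v.norm_sq_eq
  simp only [h1, norm_zero, ne_eq, OfNat.ofNat_ne_zero, not_false_eq_true, zero_pow,
    Finset.sum_const_zero] at h2
  simpa using h2

/-- A test function as an element of `H^k(Ω)`. -/
def IsTestFunction.toSobolev (hφ : IsTestFunction Ω φ) (k : ℕ) : sobolev k Ω :=
  ⟨WithLp.toLp 2 fun α => (hφ.multiDeriv α).toL2, fun α ψ hψ => by
    have h1 := integral_mul_multiDeriv hφ.contDiff hψ α
    rw [← inner_toL2_toL2 hφ (hψ.multiDeriv α), ← inner_toL2_toL2 (hφ.multiDeriv α) hψ,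
      inner_toL2, inner_toL2] at h1
    exact h1⟩

theorem IsTestFunction.isTestElement (hφ : IsTestFunction Ω φ) (k : ℕ) :
    IsTestElement (hφ.toSobolev k) :=
  ⟨φ, hφ, fun α => (hφ.multiDeriv α).coeFn_toL2⟩

/-- A test function as an element of `H^k_0(Ω)`. -/
def IsTestFunction.toHZero (hφ : IsTestFunction Ω φ) (k : ℕ) : HZero k Ω :=
  (⟨hφ.toSobolev k, Submodule.le_topologicalClosure _
    (Submodule.subset_span (hφ.isTestElement k))⟩ : sobolevZero k Ω)

theorem IsTestFunction.toL2_toHZero (hφ : IsTestFunction Ω φ) :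
    Biharm.toL2 Ω (hφ.toHZero k) = hφ.toL2 := rfl

theorem IsTestElement.exists_eq {U : sobolev k Ω} (hU : IsTestElement U) :
    ∃ φ : Plane → ℝ, ∃ hφ : IsTestFunction Ω φ, U = hφ.toSobolev k := by
  obtain ⟨φ, hφ, h⟩ := hU
  refine ⟨φ, hφ, Subtype.ext (PiLp.ext fun α => Lp.ext ?_)⟩
  exact (h α).trans (hφ.multiDeriv α).coeFn_toL2.symm

theorem partialDeriv_add (hφ : ContDiff ℝ ∞ φ) (hψ : ContDiff ℝ ∞ ψ) (i : Fin 2) :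
    partialDeriv i (φ + ψ) = partialDeriv i φ + partialDeriv i ψ := by
  funext x
  unfold partialDeriv
  rw [fderiv_add (hφ.differentiable (by simp) x) (hψ.differentiable (by simp) x)]
  rfl

theorem partialDeriv_const_smul (hφ : ContDiff ℝ ∞ φ) (c : ℝ) (i : Fin 2) :
    partialDeriv i (c • φ) = c • partialDeriv i φ := by
  funext x
  unfold partialDeriv
  rw [fderiv_const_smul (hφ.differentiable (by simp) x)]
  rfl

theorem iterate_partialDeriv_add (hφ : ContDiff ℝ ∞ φ) (hψ : ContDiff ℝ ∞ ψ) (i : Fin 2) (n : ℕ) :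
    (partialDeriv i)^[n] (φ + ψ) = (partialDeriv i)^[n] φ + (partialDeriv i)^[n] ψ := by
  induction n with
  | zero => rfl
  | succ n ih =>
    simp only [Function.iterate_succ_apply']
    rw [ih, partialDeriv_add (contDiff_iterate_partialDeriv hφ i n)
      (contDiff_iterate_partialDeriv hψ i n)]

theorem iterate_partialDeriv_const_smul (hφ : ContDiff ℝ ∞ φ) (c : ℝ) (i : Fin 2) (n : ℕ) :
    (partialDeriv i)^[n] (c • φ) = c • (partialDeriv i)^[n] φ := by
  induction n with
  | zero => rfl
  | succ n ih =>
    simp only [Function.iterate_succ_apply']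
    rw [ih, partialDeriv_const_smul (contDiff_iterate_partialDeriv hφ i n)]

/-- Test elements form a subspace, so that they are dense in `H^k_0(Ω)`. -/
theorem isTestElement_of_mem_span {U : sobolev k Ω}
    (hU : U ∈ Submodule.span ℝ {U : sobolev k Ω | IsTestElement U}) : IsTestElement U := by
  induction hU using Submodule.span_induction with
  | mem U h => exact h
  | zero =>
    refine ⟨0, ⟨contDiff_const, HasCompactSupport.zero, by simp⟩, fun α => ?_⟩
    have h1 : multiDeriv α (0 : Plane → ℝ) = 0 := by
      have h2 : ∀ (i : Fin 2) (n : ℕ), (partialDeriv i)^[n] (0 : Plane → ℝ) = 0 := fun i n => by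
        have := iterate_partialDeriv_const_smul (φ := 0) contDiff_const 0 i n
        rwa [zero_smul, zero_smul] at this
      unfold multiDeriv
      rw [h2, h2]
    rw [h1]
    exact Lp.coeFn_zero ℝ 2 (vol Ω)
  | add U V _ _ hU hV =>
    obtain ⟨φ, hφ, hU⟩ := hU
    obtain ⟨ψ, hψ, hV⟩ := hV
    refine ⟨φ + ψ, ⟨hφ.contDiff.add hψ.contDiff, hφ.hasCompactSupport.add hψ.hasCompactSupport,
      (tsupport_add φ ψ).trans (union_subset hφ.tsupport_subset hψ.tsupport_subset)⟩, fun α => ?_⟩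
    have h1 : multiDeriv α (φ + ψ) = multiDeriv α φ + multiDeriv α ψ := by
      unfold multiDeriv
      rw [iterate_partialDeriv_add hφ.contDiff hψ.contDiff,
        iterate_partialDeriv_add (contDiff_iterate_partialDeriv hφ.contDiff _ _)
          (contDiff_iterate_partialDeriv hψ.contDiff _ _)]
    rw [h1]
    exact (Lp.coeFn_add (U.1 α) (V.1 α)).trans ((hU α).add (hV α))
  | smul c U _ hU =>
    obtain ⟨φ, hφ, hU⟩ := hU
    refine ⟨c • φ, ⟨contDiff_const.smul hφ.contDiff, hφ.hasCompactSupport.smul_left,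
      (tsupport_smul_subset_right (fun _ => c) φ).trans hφ.tsupport_subset⟩, fun α => ?_⟩
    have h1 : multiDeriv α (c • φ) = c • multiDeriv α φ := by
      unfold multiDeriv
      rw [iterate_partialDeriv_const_smul hφ.contDiff,
        iterate_partialDeriv_const_smul (contDiff_iterate_partialDeriv hφ.contDiff _ _)]
    rw [h1]
    exact (Lp.coeFn_smul c (U.1 α)).trans ((hU α).const_smul c)

theorem HZero.mem_closure_toHZero (v : HZero k Ω) :
    v ∈ closure {u : HZero k Ω | ∃ φ : Plane → ℝ, ∃ hφ : IsTestFunction Ω φ, u = hφ.toHZero k} := by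
  have hv : inclusion k Ω v ∈ closure
      ((Submodule.span ℝ {U : sobolev k Ω | IsTestElement U} : Submodule ℝ (sobolev k Ω)) :
        Set (sobolev k Ω)) := by
    have h1 : inclusion k Ω v ∈ sobolevZero k Ω :=
      (show sobolevZero k Ω from v).2
    exact h1
  have hiso : Isometry (inclusion k Ω) := fun _ _ => rfl
  rw [hiso.isUniformInducing.isInducing.closure_eq_preimage_closure_image, mem_preimage]
  refine closure_mono ?_ hv
  intro U hU
  obtain ⟨φ, hφ, rfl⟩ := (isTestElement_of_mem_span hU).exists_eq
  exact ⟨hφ.toHZero k, ⟨φ, hφ, rfl⟩, rfl⟩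

/-- A closed property of all test functions holds in `H^k_0(Ω)`. -/
theorem HZero.induction {p : HZero k Ω → Prop} (hp : IsClosed {v | p v})
    (h : ∀ φ : Plane → ℝ, ∀ hφ : IsTestFunction Ω φ, p (hφ.toHZero k)) (v : HZero k Ω) : p v :=
  closure_minimal (s := {u | ∃ φ : Plane → ℝ, ∃ hφ : IsTestFunction Ω φ, u = hφ.toHZero k})
    (fun _ ⟨φ, hφ, hu⟩ => hu ▸ h φ hφ) hp v.mem_closure_toHZero

end SobolevSpaces

/-! ### The gradient, the Laplacian and their estimates -/

section Estimates

variable {Ω : Set Plane} {φ ψ : Plane → ℝ}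

/-- A multi-index of length at most `1`, as one of length at most `2`. -/
def liftIdx (α : MultiIndex 1) : MultiIndex 2 :=
  ⟨fun i => (α.1 i).castLE (by norm_num), α.2.trans (by norm_num)⟩

/-- The multi-index of `∂₀ ∂₁`. -/
def mixedIdx : MultiIndex 2 := ⟨fun _ => 1, by decide⟩

theorem eq_zeroIdx_or_firstIdx : ∀ α : MultiIndex 1,
    α = zeroIdx 1 ∨ α = firstIdx 0 ∨ α = firstIdx 1 := by decide

theorem multiIndex_two_cases : ∀ α : MultiIndex 2,
    α = zeroIdx 2 ∨ α = liftIdx (firstIdx 0) ∨ α = liftIdx (firstIdx 1) ∨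
      α = pureSecondIdx 0 ∨ α = pureSecondIdx 1 ∨ α = mixedIdx := by decide

theorem multiDeriv_firstIdx (i : Fin 2) (φ : Plane → ℝ) :
    multiDeriv (firstIdx i) φ = partialDeriv i φ := by
  fin_cases i <;> rfl

theorem multiDeriv_pureSecondIdx (i : Fin 2) (φ : Plane → ℝ) :
    multiDeriv (pureSecondIdx i) φ = partialDeriv i (partialDeriv i φ) := by
  fin_cases i <;> rfl

/-- The inclusion `H²(Ω) → H¹(Ω)`, which forgets the second derivatives. -/
def sobolevInclusion (Ω : Set Plane) : sobolev 2 Ω →L[ℝ] sobolev 1 Ω :=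
  (((PiLp.continuousLinearEquiv 2 ℝ fun _ : MultiIndex 1 => L2 Ω).symm.toContinuousLinearMap ∘L
    ContinuousLinearMap.pi fun α =>
      PiLp.proj (𝕜 := ℝ) 2 (fun _ : MultiIndex 2 => L2 Ω) (liftIdx α)) ∘L
    (sobolev 2 Ω).subtypeL).codRestrict (sobolev 1 Ω) fun U α => U.2 (liftIdx α)

/-- The inclusion `H^2_0(Ω) → H^1_0(Ω)`. -/
def toH10 (Ω : Set Plane) : H20 Ω →L[ℝ] H10 Ω :=
  (sobolevInclusion Ω ∘L inclusion 2 Ω).codRestrict (sobolevZero 1 Ω) fun v => by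
    refine HZero.induction (p := fun v => (sobolevInclusion Ω ∘L inclusion 2 Ω) v ∈ sobolevZero 1 Ω)
      ?_ (fun φ hφ => ?_) v
    · exact (Submodule.isClosed_topologicalClosure _).preimage
        (sobolevInclusion Ω ∘L inclusion 2 Ω).continuous
    · exact (show sobolevZero 1 Ω from hφ.toHZero 1).2

theorem toL2_toH10 (v : H20 Ω) : toL2 Ω (toH10 Ω v) = toL2 Ω v := rfl

theorem toH10_injective (hΩ : IsOpen Ω) (hΩb : Bornology.IsBounded Ω) :
    Function.Injective (toH10 Ω) := fun u v h =>
  toL2_injective hΩ hΩb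
    (congrArg (toL2 (k := 1) Ω) h : toL2 Ω (toH10 Ω u) = toL2 Ω (toH10 Ω v))

theorem denseRange_toH10 : DenseRange (toH10 Ω) := fun v =>
  HZero.induction (p := fun v => v ∈ closure (range (toH10 Ω))) isClosed_closure
    (fun _ hφ => subset_closure ⟨hφ.toHZero 2, rfl⟩) v

/-- The gradient `H^1_0(Ω) → L²(Ω)²`. -/
def gradient (Ω : Set Plane) : H10 Ω →L[ℝ] PiLp 2 fun _ : Fin 2 => L2 Ω :=
  (PiLp.continuousLinearEquiv 2 ℝ fun _ : Fin 2 => L2 Ω).symm.toContinuousLinearMap ∘L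
    ContinuousLinearMap.pi fun i => weakDeriv Ω (firstIdx i)

theorem norm_gradient (v : H10 Ω) : ‖gradient Ω v‖ = gradNorm v :=
  PiLp.norm_eq_of_L2 _

/-- The Poincaré inequality in `H^1_0(Ω)`. -/
theorem exists_norm_le_gradient (hΩ : IsOpen Ω) (hΩb : Bornology.IsBounded Ω) :
    ∃ C : ℝ, 0 ≤ C ∧ ∀ v : H10 Ω, ‖v‖ ≤ C * ‖gradient Ω v‖ := by
  obtain ⟨R, hR0, hR⟩ := hΩb.exists_pos_norm_le
  have hle : ∀ (v : H10 Ω) (i : Fin 2), ‖weakDeriv Ω (firstIdx i) v‖ ≤ ‖gradient Ω v‖ :=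
    fun v i => PiLp.norm_apply_le (gradient Ω v) i
  have hzero : ∀ v : H10 Ω, ‖weakDeriv Ω (zeroIdx 1) v‖ ≤ 2 * R * ‖gradient Ω v‖ := by
    intro v
    refine HZero.induction (p := fun v => ‖weakDeriv Ω (zeroIdx 1) v‖ ≤ 2 * R * ‖gradient Ω v‖)
      (isClosed_le (by fun_prop) (by fun_prop)) (fun φ hφ => ?_) v
    refine (norm_toL2_le_partialDeriv hR hΩ hφ).trans ?_
    exact mul_le_mul_of_nonneg_left (hle (hφ.toHZero 1) 0) (by positivity)
  have hall : ∀ (v : H10 Ω) (α : MultiIndex 1),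
      ‖weakDeriv Ω α v‖ ^ 2 ≤ ((2 * R + 1) * ‖gradient Ω v‖) ^ 2 := by
    intro v α
    have h0 := norm_nonneg (gradient Ω v)
    refine pow_le_pow_left₀ (norm_nonneg _) ?_ 2
    rcases eq_zeroIdx_or_firstIdx α with rfl | rfl | rfl
    · linarith [hzero v]
    · nlinarith [hle v 0]
    · nlinarith [hle v 1]
  refine ⟨Real.sqrt (Fintype.card (MultiIndex 1)) * (2 * R + 1), by positivity, fun v => ?_⟩
  refine le_of_sq_le_sq ?_ (by positivity)
  rw [v.norm_sq_eq, mul_assoc, mul_pow, Real.sq_sqrt (by positivity)]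
  refine (Finset.sum_le_sum fun α _ => hall v α).trans_eq ?_
  simp

/-- The `H²` norm is controlled by the Laplacian on `H^2_0(Ω)`: for test functions,
`‖Δφ‖² = ‖∂₀²φ‖² + 2 ‖∂₀∂₁φ‖² + ‖∂₁²φ‖²`, and the Poincaré inequality bounds the lower order
derivatives. -/
theorem exists_norm_le_laplacian (hΩ : IsOpen Ω) (hΩb : Bornology.IsBounded Ω) :
    ∃ C : ℝ, 0 < C ∧ ∀ v : H20 Ω, ‖v‖ ≤ C * ‖laplacian Ω v‖ := by
  obtain ⟨R, hR0, hR⟩ := hΩb.exists_pos_norm_le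
  have hlap : ∀ v : H20 Ω, laplacian Ω v
      = weakDeriv Ω (pureSecondIdx 0) v + weakDeriv Ω (pureSecondIdx 1) v := fun v => by
    simp [laplacian, Fin.sum_univ_two]
  set M := 4 * R ^ 2 + 2 * R + 1 with hM
  have hall : ∀ (v : H20 Ω) (α : MultiIndex 2), ‖weakDeriv Ω α v‖ ≤ M * ‖laplacian Ω v‖ := by
    intro v α
    refine HZero.induction (p := fun v => ‖weakDeriv Ω α v‖ ≤ M * ‖laplacian Ω v‖)
      (isClosed_le (by fun_prop) (by fun_prop)) (fun φ hφ => ?_) v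
    set L := ‖laplacian Ω (hφ.toHZero 2)‖ with hL
    have hL0 : 0 ≤ L := norm_nonneg _
    set a := ((hφ.partialDeriv 0).partialDeriv 0).toL2
    set b := ((hφ.partialDeriv 1).partialDeriv 1).toL2
    set m := ((hφ.partialDeriv 1).partialDeriv 0).toL2
    have hLsq : L ^ 2 = ‖a‖ ^ 2 + 2 * ‖m‖ ^ 2 + ‖b‖ ^ 2 := by
      rw [hL, hlap]
      change ‖a + b‖ ^ 2 = _
      rw [norm_add_sq_real, inner_pure_second hφ]
    have ha : ‖a‖ ≤ L := le_of_sq_le_sq (by nlinarith [sq_nonneg ‖m‖, sq_nonneg ‖b‖]) hL0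
    have hb : ‖b‖ ≤ L := le_of_sq_le_sq (by nlinarith [sq_nonneg ‖m‖, sq_nonneg ‖a‖]) hL0
    have hm : ‖m‖ ≤ L := le_of_sq_le_sq (by nlinarith [sq_nonneg ‖a‖, sq_nonneg ‖b‖]) hL0
    have h0 : ‖(hφ.partialDeriv 0).toL2‖ ≤ 2 * R * L :=
      (norm_toL2_le_partialDeriv hR hΩ (hφ.partialDeriv 0)).trans
        (mul_le_mul_of_nonneg_left ha (by positivity))
    have h1 : ‖(hφ.partialDeriv 1).toL2‖ ≤ 2 * R * L :=
      (norm_toL2_le_partialDeriv hR hΩ (hφ.partialDeriv 1)).trans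
        (mul_le_mul_of_nonneg_left hm (by positivity))
    have h2 : ‖hφ.toL2‖ ≤ 2 * R * (2 * R * L) :=
      (norm_toL2_le_partialDeriv hR hΩ hφ).trans
        (mul_le_mul_of_nonneg_left h0 (by positivity))
    have e0 : 0 ≤ R ^ 2 * L := by positivity
    have e1 : 0 ≤ R * L := by positivity
    have eM : M * L = 4 * (R ^ 2 * L) + 2 * (R * L) + L := by rw [hM]; ring
    rw [eM]
    rcases multiIndex_two_cases α with rfl | rfl | rfl | rfl | rfl | rfl
    · change ‖hφ.toL2‖ ≤ _
      linarith
    · change ‖(hφ.partialDeriv 0).toL2‖ ≤ _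
      linarith
    · change ‖(hφ.partialDeriv 1).toL2‖ ≤ _
      linarith
    · change ‖a‖ ≤ _
      linarith
    · change ‖b‖ ≤ _
      linarith
    · change ‖m‖ ≤ _
      linarith
  have hM0 : 0 < M := by positivity
  have hcard : 0 < (Fintype.card (MultiIndex 2) : ℝ) := by
    exact_mod_cast Fintype.card_pos_iff.2 ⟨zeroIdx 2⟩
  refine ⟨Real.sqrt (Fintype.card (MultiIndex 2)) * M, by positivity, fun v => ?_⟩
  refine le_of_sq_le_sq ?_ (by positivity)
  rw [v.norm_sq_eq, mul_assoc, mul_pow, Real.sq_sqrt (by positivity)]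
  refine (Finset.sum_le_sum fun α _ =>
    pow_le_pow_left₀ (norm_nonneg _) (hall v α) 2).trans_eq ?_
  simp

/-- Green's formula `(Δv, u) = -(∇v, ∇u)` for `v, u ∈ H^2_0(Ω)`. -/
theorem laplacianDual_apply (v u : H20 Ω) :
    laplacianDual Ω v u = -inner ℝ (gradient Ω (toH10 Ω v)) (gradient Ω (toH10 Ω u)) := by
  have h0 : ∀ u, laplacianDual Ω v u = inner ℝ (laplacian Ω v) (toL2 Ω u) := fun u => rfl
  refine HZero.induction (p := fun u => laplacianDual Ω v u
    = -inner ℝ (gradient Ω (toH10 Ω v)) (gradient Ω (toH10 Ω u)))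
    (isClosed_eq (by fun_prop) (by fun_prop)) (fun φ hφ => ?_) u
  rw [h0, PiLp.inner_apply, hφ.toL2_toHZero]
  simp only [laplacian, sum_apply]
  rw [sum_inner, ← Finset.sum_neg_distrib]
  refine Finset.sum_congr rfl fun i _ => ?_
  have h1 := v.inner_weakDeriv (pureSecondIdx i) hφ
  have h2 := v.inner_weakDeriv (liftIdx (firstIdx i)) (hφ.partialDeriv i)
  have h3 : gradient Ω (toH10 Ω v) i = weakDeriv Ω (liftIdx (firstIdx i)) v := rfl
  have h4 : gradient Ω (toH10 Ω (hφ.toHZero 2)) i = (hφ.partialDeriv i).toL2 :=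
    toL2_congr (hφ.multiDeriv _) _ (multiDeriv_firstIdx i φ)
  have h5 : (hφ.multiDeriv (pureSecondIdx i)).toL2
      = ((hφ.partialDeriv i).multiDeriv (liftIdx (firstIdx i))).toL2 :=
    toL2_congr _ ((hφ.partialDeriv i).multiDeriv _)
      ((multiDeriv_pureSecondIdx i φ).trans (multiDeriv_firstIdx i _).symm)
  have h6 : (pureSecondIdx i).length = 2 := by fin_cases i <;> rfl
  have h7 : (liftIdx (firstIdx i)).length = 1 := by fin_cases i <;> rfl
  rw [h3, h4, h1, h2, h5, h6, h7]
  ring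

end Estimates

/-! ### The weak formulation in time as an equation in `H^2_0(Ω)` -/

section Riesz

variable {Ω : Set Plane} {T : ℝ}

/-- The Riesz isomorphism `H^{-2}(Ω) → H^2_0(Ω)`, for the full `H²` inner product and not for
`(Δu, Δv)`. -/
def riesz (Ω : Set Plane) : HNeg2 Ω ≃ₗᵢ[ℝ] H20 Ω := (InnerProductSpace.toDual ℝ (H20 Ω)).symm

theorem inner_riesz (f : HNeg2 Ω) (u : H20 Ω) : inner ℝ (riesz Ω f) u = f u :=
  InnerProductSpace.toDual_symm_apply

/-- The gradient `H^2_0(Ω) → L²(Ω)²`. -/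
def gradient₂ (Ω : Set Plane) : H20 Ω →L[ℝ] PiLp 2 fun _ : Fin 2 => L2 Ω :=
  gradient Ω ∘L toH10 Ω

theorem riesz_laplacianDual (v : H20 Ω) :
    riesz Ω (laplacianDual Ω v) = -(gradient₂ Ω).adjoint (gradient Ω (toH10 Ω v)) := by
  refine ext_inner_right ℝ fun u => ?_
  rw [inner_riesz, laplacianDual_apply, inner_neg_left, ContinuousLinearMap.adjoint_inner_left]
  rfl

/-- The operator on `H^2_0(Ω)` which represents the form `(Δu, Δv)` in the `H²` inner product. -/
def bilaplacian (Ω : Set Plane) : H20 Ω →L[ℝ] H20 Ω :=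
  (laplacian Ω).adjoint ∘L laplacian Ω

theorem inner_bilaplacian (u v : H20 Ω) :
    inner ℝ (bilaplacian Ω u) v = inner ℝ (laplacian Ω u) (laplacian Ω v) := by
  rw [bilaplacian, ContinuousLinearMap.comp_apply, ContinuousLinearMap.adjoint_inner_left]

theorem inner_bilaplacian_comm (u v : H20 Ω) :
    inner ℝ (bilaplacian Ω u) v = inner ℝ u (bilaplacian Ω v) := by
  rw [inner_bilaplacian, real_inner_comm, ← inner_bilaplacian, real_inner_comm]

/-- The Riesz isomorphism, pointwise in time. -/
def rieszTime (f : L2Time T (HNeg2 Ω)) : L2Time T (H20 Ω) :=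
  ((riesz Ω).toContinuousLinearEquiv : HNeg2 Ω →L[ℝ] H20 Ω).compLp f

theorem coeFn_rieszTime (f : L2Time T (HNeg2 Ω)) :
    ∀ᵐ t ∂timeMeasure T, rieszTime f t = riesz Ω (f t) :=
  ContinuousLinearMap.coeFn_compLp _ _

theorem norm_rieszTime (f : L2Time T (HNeg2 Ω)) : ‖rieszTime f‖ = ‖f‖ := by
  have h : ∀ᵐ t ∂timeMeasure T, ‖rieszTime f t‖ = ‖f t‖ :=
    (coeFn_rieszTime f).mono fun t ht => by rw [ht, LinearIsometryEquiv.norm_map]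
  exact le_antisymm (Lp.norm_le_norm_of_ae_le (h.mono fun _ => le_of_eq))
    (Lp.norm_le_norm_of_ae_le (h.mono fun _ => ge_of_eq))

theorem exists_rieszTime_eq (F : L2Time T (H20 Ω)) :
    ∃ f : L2Time T (HNeg2 Ω), rieszTime f = F := by
  refine ⟨((riesz Ω).symm.toContinuousLinearEquiv : H20 Ω →L[ℝ] HNeg2 Ω).compLp F, Lp.ext ?_⟩
  filter_upwards [coeFn_rieszTime
    (((riesz Ω).symm.toContinuousLinearEquiv : H20 Ω →L[ℝ] HNeg2 Ω).compLp F),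
    ContinuousLinearMap.coeFn_compLp
      ((riesz Ω).symm.toContinuousLinearEquiv : H20 Ω →L[ℝ] HNeg2 Ω) F] with t h1 h2
  rw [h1, h2]
  exact (riesz Ω).apply_symm_apply _

theorem integrable_L2Time {E : Type} [NormedAddCommGroup E] (v : L2Time T E) :
    Integrable v (timeMeasure T) := (Lp.memLp v).integrable (by norm_num)

theorem integral_norm_mul_norm_le {E : Type} [NormedAddCommGroup E] (v g : L2Time T E) :
    ∫ t, ‖v t‖ * ‖g t‖ ∂timeMeasure T ≤ ‖v‖ * ‖g‖ := by
  have h1 := real_inner_le_norm (Lp.memLp v).norm.toLp (Lp.memLp g).norm.toLp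
  have h2 : ∀ u : L2Time T E, ‖(Lp.memLp u).norm.toLp‖ = ‖u‖ := fun u => by
    rw [Lp.norm_toLp, eLpNorm_norm, Lp.norm_def]
  rw [h2, h2, L2.inner_def] at h1
  refine le_trans (le_of_eq (integral_congr_ae ?_)) h1
  filter_upwards [(Lp.memLp v).norm.coeFn_toLp, (Lp.memLp g).norm.coeFn_toLp] with t h3 h4
  rw [h3, h4]
  simp [mul_comm]

/-- `g = ∂_t Δv` if and only if `-Δv`, seen in `H^2_0(Ω)`, is a primitive of `-g`. -/
theorem isTimeDerivLaplacian_iff (hT : 0 < T) (v : L2Time T (H20 Ω)) (g : L2Time T (HNeg2 Ω)) :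
    IsTimeDerivLaplacian v g ↔ ∃ c : H20 Ω, ∀ᵐ t ∂timeMeasure T,
      (gradient₂ Ω).adjoint (gradient Ω (toH10 Ω (v t)))
        = c + ∫ s in (0 : ℝ)..t, -rieszTime g s := by
  have hvi : Integrable (fun t => (gradient₂ Ω).adjoint (gradient Ω (toH10 Ω (v t))))
      (timeMeasure T) :=
    ((gradient₂ Ω).adjoint ∘L gradient Ω ∘L toH10 Ω).integrable_comp (integrable_L2Time v)
  have hgi : Integrable (fun t => -rieszTime g t) (timeMeasure T) :=
    (integrable_L2Time (rieszTime g)).neg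
  rw [← forall_integral_deriv_smul_iff hT hvi hgi]
  refine forall_congr' fun η => forall_congr' fun _ => forall_congr' fun _ =>
    forall_congr' fun _ => ?_
  rw [← (riesz Ω).injective.eq_iff, map_neg]
  have hcomm : ∀ p : ℝ → HNeg2 Ω, riesz Ω (∫ t, p t ∂timeMeasure T)
      = ∫ t, riesz Ω (p t) ∂timeMeasure T := fun p =>
    ((riesz Ω).toContinuousLinearEquiv.integral_comp_comm p).symm
  rw [hcomm, hcomm]
  have h1 : ∫ t, riesz Ω (deriv η t • laplacianDual Ω (v t)) ∂timeMeasure T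
      = -∫ t, deriv η t • (gradient₂ Ω).adjoint (gradient Ω (toH10 Ω (v t))) ∂timeMeasure T := by
    rw [← integral_neg]
    refine integral_congr_ae (ae_of_all _ fun t => ?_)
    simp only
    rw [map_smul, riesz_laplacianDual, smul_neg]
  have h2 : ∫ t, riesz Ω (η t • g t) ∂timeMeasure T
      = -∫ t, η t • -rieszTime g t ∂timeMeasure T := by
    rw [← integral_neg]
    refine integral_congr_ae ((coeFn_rieszTime g).mono fun t ht => ?_)
    simp only
    rw [map_smul, ht, smul_neg, neg_neg]
  rw [h1, h2, neg_inj]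

/-- The variational equation, tested with all of `L²(I; H^2_0(Ω))`, holds pointwise in time. -/
theorem equation_iff (f g : L2Time T (HNeg2 Ω)) (ψ : L2Time T (H20 Ω)) :
    (∀ φ : L2Time T (H20 Ω), -(∫ t, g t (φ t) ∂timeMeasure T)
      + ∫ t, inner ℝ (laplacian Ω (ψ t)) (laplacian Ω (φ t)) ∂timeMeasure T
        = ∫ t, f t (φ t) ∂timeMeasure T) ↔
      rieszTime g = (bilaplacian Ω).compLp ψ - rieszTime f := by
  have h1 : ∀ (p : L2Time T (HNeg2 Ω)) (φ : L2Time T (H20 Ω)),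
      ∫ t, p t (φ t) ∂timeMeasure T = inner ℝ (rieszTime p) φ := fun p φ => by
    rw [L2.inner_def]
    refine integral_congr_ae ((coeFn_rieszTime p).mono fun t ht => ?_)
    simp only
    rw [ht, inner_riesz]
  have h2 : ∀ φ : L2Time T (H20 Ω),
      ∫ t, inner ℝ (laplacian Ω (ψ t)) (laplacian Ω (φ t)) ∂timeMeasure T
        = inner ℝ ((bilaplacian Ω).compLp ψ) φ := fun φ => by
    rw [L2.inner_def]
    refine integral_congr_ae (((bilaplacian Ω).coeFn_compLp ψ).mono fun t ht => ?_)
    simp only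
    rw [ht, inner_bilaplacian]
  simp_rw [h1, h2]
  constructor
  · intro h
    refine ext_inner_right ℝ fun φ => ?_
    rw [inner_sub_left]
    linarith [h φ]
  · intro h φ
    rw [h, inner_sub_left]
    ring

end Riesz

/-! ### Traces in time and the solution -/

section ContRep

variable {Ω : Set Plane} {T : ℝ}

theorem IsContRep.ae_eq (hΩ : IsOpen Ω) (hΩb : Bornology.IsBounded Ω) {v : L2Time T (H20 Ω)}
    {w : C(Icc (0 : ℝ) T, H10 Ω)} (h : IsContRep v w) :
    ∀ᵐ t ∂timeMeasure T, ∀ ht : t ∈ Icc (0 : ℝ) T, w ⟨t, ht⟩ = toH10 Ω (v t) :=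
  h.mono fun t ht htI => toL2_injective hΩ hΩb ((ht htI).trans (toL2_toH10 (v t)).symm)

theorem IsContRep.unique (hΩ : IsOpen Ω) (hΩb : Bornology.IsBounded Ω) (hT : 0 < T)
    {v : L2Time T (H20 Ω)} {w w' : C(Icc (0 : ℝ) T, H10 Ω)} (h : IsContRep v w)
    (h' : IsContRep v w') : w = w' := by
  have h1 : EqOn (fun t => w (projIcc 0 T hT.le t)) (fun t => w' (projIcc 0 T hT.le t))
      (Icc 0 T) := by
    refine Measure.eqOn_Icc_of_ae_eq volume hT.ne ?_ (by fun_prop) (by fun_prop)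
    rw [← restrict_Ioc_eq_restrict_Icc]
    filter_upwards [h.ae_eq hΩ hΩb, h'.ae_eq hΩ hΩb, ae_restrict_mem measurableSet_Ioc]
      with t h2 h3 ht
    have htI : t ∈ Icc 0 T := Ioc_subset_Icc_self ht
    rw [projIcc_of_mem hT.le htI, h2 htI, h3 htI]
  ext1 t
  have h2 := h1 t.2
  simpa only [projIcc_val] using h2

/-- The elements of `𝕏` have a representative in `C([0, T]; H^1_0(Ω))`, with an energy bound. The
constant `c` of integration is `-Δ` of its initial value. -/
theorem exists_isContRep (hΩ : IsOpen Ω) (hΩb : Bornology.IsBounded Ω) (hT : 0 < T)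
    {v : L2Time T (H20 Ω)} {g : L2Time T (HNeg2 Ω)} {c : H20 Ω}
    (h : ∀ᵐ t ∂timeMeasure T, (gradient₂ Ω).adjoint (gradient Ω (toH10 Ω (v t)))
        = c + ∫ s in (0 : ℝ)..t, -rieszTime g s) :
    ∃ w : C(Icc (0 : ℝ) T, H10 Ω), IsContRep v w ∧
      (gradient₂ Ω).adjoint (gradient Ω (w ⟨0, ⟨le_rfl, hT.le⟩⟩)) = c ∧
      ∀ t, ‖gradient Ω (w t)‖ ^ 2
        ≤ ‖gradient Ω (w ⟨0, ⟨le_rfl, hT.le⟩⟩)‖ ^ 2 + 2 * (‖v‖ * ‖g‖) := by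
  obtain ⟨C, -, hC⟩ := exists_norm_le_gradient hΩ hΩb
  obtain ⟨w, hw, hwc, hwn⟩ := exists_continuous_representative hT (toH10 Ω)
    (toH10_injective hΩ hΩb) (gradient Ω) hC (Lp.memLp v) (Lp.memLp (rieszTime g)).neg c h
  refine ⟨w, hw.mono fun t ht htI => by rw [ht htI, toL2_toH10], ?_, fun t => ?_⟩
  · exact (hwc _).trans (by simp)
  · refine (hwn t).trans ?_
    have h1 := integral_norm_mul_norm_le v (rieszTime g)
    rw [norm_rieszTime] at h1
    simp only [Pi.neg_apply, norm_neg]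
    linarith

/-- `v ↦ (φ ↦ (∇v, ∇φ))` is injective on `H^1_0(Ω)`, since `H^2_0(Ω)` is dense in `H^1_0(Ω)`. -/
theorem adjoint_gradient_injective (hΩ : IsOpen Ω) (hΩb : Bornology.IsBounded Ω) :
    Function.Injective fun v : H10 Ω => (gradient₂ Ω).adjoint (gradient Ω v) := by
  obtain ⟨C, -, hC⟩ := exists_norm_le_gradient hΩ hΩb
  refine (injective_iff_map_eq_zero ((gradient₂ Ω).adjoint ∘L gradient Ω)).2 fun v hv => ?_
  have h1 : ∀ u : H10 Ω, inner ℝ (gradient Ω v) (gradient Ω u) = 0 := by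
    intro u
    refine denseRange_toH10.induction_on
      (p := fun u => inner ℝ (gradient Ω v) (gradient Ω u) = 0) u
      (isClosed_eq (by fun_prop) continuous_const) fun u => ?_
    have h2 : inner ℝ ((gradient₂ Ω).adjoint (gradient Ω v)) u
      = inner ℝ (gradient Ω v) (gradient Ω (toH10 Ω u)) :=
      ContinuousLinearMap.adjoint_inner_left _ _ _
    rw [← h2]
    exact (congrArg (fun x => inner ℝ x u) hv).trans (inner_zero_left u)
  have h2 := hC v
  rw [inner_self_eq_zero.1 (h1 v), norm_zero, mul_zero] at h2
  exact norm_le_zero_iff.1 h2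

/-- Weak solutions are the solutions of the equation integrated in time. -/
theorem isWeakSolution_iff (hΩ : IsOpen Ω) (hΩb : Bornology.IsBounded Ω) (hT : 0 < T)
    (f : L2Time T (HNeg2 Ω)) (ψ₀ : H10 Ω) (ψ : L2Time T (H20 Ω)) :
    IsWeakSolution f ψ₀ ψ ↔ ∀ᵐ t ∂timeMeasure T,
      (gradient₂ Ω).adjoint (gradient₂ Ω (ψ t)) + ∫ s in (0 : ℝ)..t, bilaplacian Ω (ψ s)
        = (gradient₂ Ω).adjoint (gradient Ω ψ₀) + ∫ s in (0 : ℝ)..t, rieszTime f s := by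
  have hint : ∀ g : L2Time T (HNeg2 Ω),
      rieszTime g = (bilaplacian Ω).compLp ψ - rieszTime f → ∀ t ∈ Ioc 0 T,
      ∫ s in (0 : ℝ)..t, -rieszTime g s
        = (∫ s in (0 : ℝ)..t, rieszTime f s) - ∫ s in (0 : ℝ)..t, bilaplacian Ω (ψ s) := by
    intro g hg t ht
    have hi : ∀ p : ℝ → H20 Ω, Integrable p (timeMeasure T) → IntervalIntegrable p volume 0 t :=
      fun p hp => (intervalIntegrable_iff_integrableOn_Ioc_of_le ht.1.le).2
        (IntegrableOn.mono_set hp (Ioc_subset_Ioc_right ht.2))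
    rw [← intervalIntegral.integral_sub (hi _ (integrable_L2Time _))
      (hi _ ((bilaplacian Ω).integrable_comp (integrable_L2Time ψ))),
      intervalIntegral.integral_of_le ht.1.le, intervalIntegral.integral_of_le ht.1.le]
    refine integral_congr_ae (ae_restrict_of_ae_restrict_of_subset (Ioc_subset_Ioc_right ht.2) ?_)
    filter_upwards [Lp.coeFn_sub ((bilaplacian Ω).compLp ψ) (rieszTime f),
      (bilaplacian Ω).coeFn_compLp ψ] with s h1 h2
    rw [hg, h1, Pi.sub_apply, h2, neg_sub]
  constructor
  · rintro ⟨⟨g, hg, heq⟩, ⟨w', hw', _, hw'0⟩⟩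
    rw [equation_iff] at heq
    obtain ⟨c, hc⟩ := (isTimeDerivLaplacian_iff hT ψ g).1 hg
    obtain ⟨w, hw, hw0, -⟩ := exists_isContRep hΩ hΩb hT hc
    obtain rfl := hw.unique hΩ hΩb hT hw'
    rw [hw'0] at hw0
    filter_upwards [hc, ae_restrict_mem measurableSet_Ioc] with t h1 ht
    rw [hint g heq t ht, ← hw0] at h1
    have h2 : gradient₂ Ω (ψ t) = gradient Ω (toH10 Ω (ψ t)) := rfl
    rw [h2, h1]
    abel
  · intro h
    obtain ⟨g, hg⟩ := exists_rieszTime_eq ((bilaplacian Ω).compLp ψ - rieszTime f)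
    have hc : ∀ᵐ t ∂timeMeasure T, (gradient₂ Ω).adjoint (gradient Ω (toH10 Ω (ψ t)))
        = (gradient₂ Ω).adjoint (gradient Ω ψ₀) + ∫ s in (0 : ℝ)..t, -rieszTime g s := by
      filter_upwards [h, ae_restrict_mem measurableSet_Ioc] with t h1 ht
      rw [hint g hg t ht, ← add_sub_assoc, ← h1, add_sub_cancel_right]
      rfl
    obtain ⟨w, hw, hw0, -⟩ := exists_isContRep hΩ hΩb hT hc
    exact ⟨⟨g, (isTimeDerivLaplacian_iff hT ψ g).2 ⟨_, hc⟩, (equation_iff f g ψ).2 hg⟩,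
      ⟨w, hw, ⟨le_rfl, hT.le⟩, adjoint_gradient_injective hΩ hΩb hw0⟩⟩

theorem IsWeakSolution.unique (hΩ : IsOpen Ω) (hΩb : Bornology.IsBounded Ω) (hT : 0 < T)
    {f : L2Time T (HNeg2 Ω)} {ψ₀ : H10 Ω} {ψ ψ' : L2Time T (H20 Ω)}
    (h : IsWeakSolution f ψ₀ ψ) (h' : IsWeakSolution f ψ₀ ψ') : ψ = ψ' := by
  rw [isWeakSolution_iff hΩ hΩb hT] at h h'
  have hinj : Function.Injective (gradient₂ Ω) := by
    obtain ⟨C, -, hC⟩ := exists_norm_le_gradient hΩ hΩb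
    refine (injective_iff_map_eq_zero _).2 fun v hv => toH10_injective hΩ hΩb ?_
    have h1 := hC (toH10 Ω v)
    have h2 : gradient Ω (toH10 Ω v) = 0 := hv
    rw [h2, norm_zero, mul_zero] at h1
    rw [norm_le_zero_iff.1 h1, map_zero]
  have hd : ∀ᵐ t ∂timeMeasure T, ψ t - ψ' t = 0 := by
    refine ae_eq_zero_of_integrated hinj inner_bilaplacian_comm
      (fun x => by rw [inner_bilaplacian]; exact real_inner_self_nonneg)
      ((Lp.memLp ψ).sub (Lp.memLp ψ')) ?_
    filter_upwards [h, h', ae_restrict_mem measurableSet_Ioc] with t h1 h2 ht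
    have hi : ∀ p : L2Time T (H20 Ω),
        IntervalIntegrable (fun s => bilaplacian Ω (p s)) volume 0 t :=
      fun p => (intervalIntegrable_iff_integrableOn_Ioc_of_le ht.1.le).2
        (IntegrableOn.mono_set ((bilaplacian Ω).integrable_comp (integrable_L2Time p))
          (Ioc_subset_Ioc_right ht.2))
    simp only [map_sub]
    rw [intervalIntegral.integral_sub (hi ψ) (hi ψ'), sub_add_sub_comm, h1, h2, sub_self]
  exact Lp.ext (hd.mono fun t ht => sub_eq_zero.1 ht)

end ContRep

end Biharm

end

theorem theorem2p9 (Ω : Set Biharm.Plane) (hΩ : IsOpen Ω) (hΩb : Bornology.IsBounded Ω) :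
    ∃ C : ℝ, 0 < C ∧ ∀ T : ℝ, 0 < T →
      (∀ v : Biharm.L2Time T (Biharm.H20 Ω), Biharm.MemX v →
        ∃! w : C(Set.Icc (0 : ℝ) T, Biharm.H10 Ω), Biharm.IsContRep v w) ∧
      ∀ (f : Biharm.L2Time T (Biharm.HNeg2 Ω)) (ψ₀ : Biharm.H10 Ω),
        (∃! ψ : Biharm.L2Time T (Biharm.H20 Ω), Biharm.IsWeakSolution f ψ₀ ψ) ∧
        ∀ ψ : Biharm.L2Time T (Biharm.H20 Ω), Biharm.IsWeakSolution f ψ₀ ψ →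
          ∃ (g : Biharm.L2Time T (Biharm.HNeg2 Ω)) (w : C(Set.Icc (0 : ℝ) T, Biharm.H10 Ω)),
            Biharm.IsTimeDerivLaplacian ψ g ∧ Biharm.IsContRep ψ w ∧
            ‖g‖ + ‖ψ‖ + ‖w‖ ≤ C * (‖f‖ + Biharm.gradNorm ψ₀) := by
  open Biharm in
  obtain ⟨CΔ, hCΔ0, hCΔ⟩ := exists_norm_le_laplacian hΩ hΩb
  obtain ⟨CP, hCP0, hCP⟩ := exists_norm_le_gradient hΩ hΩb
  set c : ℝ := (CΔ ^ 2)⁻¹ with hc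
  have hc0 : 0 < c := by positivity
  have hcoer : ∀ x : H20 Ω, c * ‖x‖ ^ 2 ≤ inner ℝ (bilaplacian Ω x) x := fun x => by
    rw [inner_bilaplacian, real_inner_self_eq_norm_sq, hc, inv_mul_le_iff₀ (by positivity),
      ← mul_pow]
    exact pow_le_pow_left₀ (norm_nonneg _) (hCΔ x) 2
  -- the constants for `ψ`, for `∂_t Δψ`, and for `∇ψ` in `C([0, T]; L²(Ω))`
  set m : ℝ := c⁻¹ + Real.sqrt (2 / c) with hm
  set m' : ℝ := ‖bilaplacian Ω‖ * m + 1 with hm'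
  set M : ℝ := Real.sqrt (1 + 2 * (m * m')) with hM
  have hm0 : 0 < m := by positivity
  have hm'0 : 0 < m' := by positivity
  have hM0 : 0 ≤ M := Real.sqrt_nonneg _
  refine ⟨m' + m + CP * M, by positivity, fun T hT => ⟨?_, fun f ψ₀ => ?_⟩⟩
  · rintro v ⟨g, hg⟩
    obtain ⟨c₀, hc₀⟩ := (isTimeDerivLaplacian_iff hT v g).1 hg
    obtain ⟨w, hw, -⟩ := exists_isContRep hΩ hΩb hT hc₀
    exact ⟨w, hw, fun w' hw' => IsContRep.unique hΩ hΩb hT hw' hw⟩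
  obtain ⟨ψ, hψn, hψ⟩ := exists_integrated_solution hT (gradient₂ Ω) (bilaplacian Ω)
    inner_bilaplacian_comm hc0 hcoer (rieszTime f) (gradient Ω ψ₀)
  have hsol : IsWeakSolution f ψ₀ ψ := (isWeakSolution_iff hΩ hΩb hT f ψ₀ ψ).2 hψ
  refine ⟨⟨ψ, hsol, fun ψ' hψ' => IsWeakSolution.unique hΩ hΩb hT hψ' hsol⟩, fun ψ' hψ' => ?_⟩
  obtain rfl := IsWeakSolution.unique hΩ hΩb hT hsol hψ'
  obtain ⟨⟨g, hg, heq⟩, ⟨w', hw', hw'I, hw'0⟩⟩ := hsol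
  obtain ⟨c₀, hc₀⟩ := (isTimeDerivLaplacian_iff hT ψ g).1 hg
  obtain ⟨w, hw, -, hwn⟩ := exists_isContRep hΩ hΩb hT hc₀
  obtain rfl := IsContRep.unique hΩ hΩb hT hw hw'
  refine ⟨g, w, hg, hw, ?_⟩
  rw [hw'0, norm_gradient] at hwn
  rw [norm_rieszTime, norm_gradient] at hψn
  set N := ‖f‖ + gradNorm ψ₀ with hN
  have hf0 : 0 ≤ ‖f‖ := norm_nonneg f
  have hg0 : 0 ≤ gradNorm ψ₀ := Real.sqrt_nonneg _
  have hN0 : 0 ≤ N := add_nonneg hf0 hg0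
  have h1 : ‖ψ‖ ≤ m * N := by
    have e1 : 0 ≤ c⁻¹ * gradNorm ψ₀ := by positivity
    have e2 : 0 ≤ Real.sqrt (2 / c) * ‖f‖ := by positivity
    rw [hm, hN]
    linarith
  have h2 : ‖g‖ ≤ m' * N := by
    rw [← norm_rieszTime, (equation_iff f g ψ).1 heq]
    have e1 := norm_sub_le ((bilaplacian Ω).compLp ψ) (rieszTime f)
    have e2 := ContinuousLinearMap.norm_compLp_le (bilaplacian Ω) ψ
    have e3 := mul_le_mul_of_nonneg_left h1 (norm_nonneg (bilaplacian Ω))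
    rw [norm_rieszTime] at e1
    rw [hm']
    linarith
  have h3 : ‖w‖ ≤ CP * M * N := by
    refine (ContinuousMap.norm_le _ (by positivity)).2 fun t => (hCP _).trans ?_
    rw [mul_assoc]
    refine mul_le_mul_of_nonneg_left (le_of_sq_le_sq ?_ (by positivity)) hCP0
    rw [mul_pow, hM, Real.sq_sqrt (by positivity)]
    have e1 : ‖ψ‖ * ‖g‖ ≤ m * N * (m' * N) :=
      mul_le_mul h1 h2 (norm_nonneg _) (by positivity)
    have e2 : gradNorm ψ₀ ^ 2 ≤ N ^ 2 := pow_le_pow_left₀ hg0 (by linarith) 2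
    linarith [hwn t]
  linarith
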